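/- Let $n>1$, $m\ge 1$ be integers. A set of $n$ rankable objects appears one at a time, at times $1,\dots,n$, in random order, all $n!$ orders being equally likely; only the relative ranks of the objects seen so far are observed. The object appearing at time $i$ is a candidate if it is the best of the first $i$ objects. If a candidate is chosen at time $i$, its duration is $T-i$, where $T$ is the arrival time of the next candidate after $i$ ($T=n+1$ if there is none). In the $m$-choice duration problem with acquisition cost $c$, one chooses successively, by stopping times with respect to the observed relative ranks, at most $m$ objects, all of them candidates; each chosen object yields its duration less the cost $c$, and the aim is to maximize the expected total net payoff. Let $U_i^{(1)}$ be the mean duration of an object appearing at time $i$, given that it is a candidate, let $H_j=\sum_{\ell=1}^j 1/\ell$ and $K(n)=\min\{i\ge1: H_n-H_i\le 1\}$, and suppose that $$0<c<U_{K(n)}^{(1)} .$$ Let $a$ and $b$ be the least and the greatest $i\in\{1,\dots,n\}$ with $U_i^{(1)}\ge c$. Then $1\le a\le K(n)\le b\le n$, and for $1\le i\le n$ we have $U_i^{(1)}\ge c$ if and only if $a\le i\le b$. Moreover, there are integers $s_1(c),\dots,s_m(c)$ in $\{1,\dots,b\}$ with the following properties. (i) Whenever there remain $k$ choices to be made ($1\le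 k\le m$), it is optimal to select the first candidate to appear at or after time $s_k(c)$ but no later than $b$. That is, the strategy given by this rule attains the maximal expected total net payoff among all strategies for the $m$-choice problem, and also, for all $1\le k\le m$, $1\le i\le n$ and all observations up to time $i$, the maximal conditional expected net payoff, given these observations, of at most $k$ choices made at times $i,\dots,n$. (ii) $s_1(c)\ge s_2(c)\ge\dots\ge s_m(c)\ge a$. (iii) The numbers $s_k(c)$ are determined as follows. Put, for $1\le i\le b$, $$G_i^{(1)}=H_n-H_{i-1}-\sum_{j=i+1}^{b}\frac{1}{j-1}\left(H_n-H_{j-1}\right)-\frac{c}{b},\qquad G_i^{(k)}=G_i^{(1)}+\sum_{j=\max(i+1,\,s_{k-1}(c))}^{b}\frac{1}{j-1}\,G_j^{(k-1)}\quad(2\le k\le m).$$ Then $s_k(c)=\min\{i\in\{1,\dots,b\}:G_i^{(k)}\ge 0\}$ for $1\le k\le m$. Furthermore, for $1\le k\le m$: if $G_i^{(k)}\ge0$ and $1\le i<b$, then $G_{i+1}^{(k)}\ge 0$; if $1\le i<s_k(c)$, then $G_{i+1}^{(k)}\ge G_i^{(k)}$; and if $k<m$, then $G_i^{(k+1)}\ge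 G_i^{(k)}$ for $1\le i\le b$. -/

import Mathlib

namespace DurationProblem

/-! A ranking of `n` objects presented at the times `1, …, n` is a permutation `σ` of `Fin n`:
`σ t` is the absolute rank (the smaller, the better) of the object presented at time `t + 1`.
All `n!` permutations are equally likely. -/

/-- The relative rank, among the objects presented so far, of the object presented at time
`t + 1`; it lies in `{1, …, t + 1}`. -/
def relRank {n : ℕ} (σ : Equiv.Perm (Fin n)) (t : Fin n) : ℕ :=
  (Finset.univ.filter fun u : Fin n => u ≤ t ∧ σ u ≤ σ t).card

/-- The object presented at time `i` (with `1 ≤ i ≤ n`) is a candidate: it is relatively best. -/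
def IsCandidate {n : ℕ} (σ : Equiv.Perm (Fin n)) (i : ℕ) : Prop :=
  ∃ t : Fin n, (t : ℕ) + 1 = i ∧ relRank σ t = 1

/-- The arrival time of the first candidate after time `i`, and `n + 1` if there is none. -/
noncomputable def nextCandidate {n : ℕ} (σ : Equiv.Perm (Fin n)) (i : ℕ) : ℕ :=
  sInf {j : ℕ | i < j ∧ (IsCandidate σ j ∨ j = n + 1)}

/-- The length of time for which an object chosen at time `i` remains a candidate. -/
noncomputable def duration {n : ℕ} (σ : Equiv.Perm (Fin n)) (i : ℕ) : ℝ :=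
  (nextCandidate σ i : ℝ) - (i : ℝ)

/-- The mean of `f` over a set `S` of rankings: the expectation of `f` conditional on `S`, and
the plain expectation for `S = univ`. -/
noncomputable def mean {n : ℕ} (S : Finset (Equiv.Perm (Fin n)))
    (f : Equiv.Perm (Fin n) → ℝ) : ℝ :=
  (∑ σ ∈ S, f σ) / (S.card : ℝ)

open Classical in
/-- `U i`: the mean duration of the object presented at time `i`, given that it is a
candidate. -/
noncomputable def meanDuration (n i : ℕ) : ℝ :=
  mean (Finset.univ.filter fun σ : Equiv.Perm (Fin n) => IsCandidate σ i) fun σ => duration σ i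

/-- The observations up to time `i`: the relative ranks of the first `i` objects. -/
def history {n : ℕ} (i : ℕ) (σ : Equiv.Perm (Fin n)) : {t : Fin n // (t : ℕ) < i} → ℕ :=
  fun t => relRank σ t.1

/-- The filtration generated by the relative ranks. -/
def rankFiltration (n : ℕ) :
    MeasureTheory.Filtration ℕ (⊤ : MeasurableSpace (Equiv.Perm (Fin n))) where
  seq i := MeasurableSpace.comap (history i) ⊤
  mono' := by
    rintro i j hij _ ⟨S, -, rfl⟩
    exact ⟨(fun (h : {t : Fin n // (t : ℕ) < j} → ℕ) (t : {t : Fin n // (t : ℕ) < i}) =>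
      h ⟨t.1, lt_of_lt_of_le t.2 hij⟩) ⁻¹' S, trivial, rfl⟩
  le' _ := le_top

open Classical in
/-- The rankings that produce the same observations up to time `i` as `σ₀`. -/
noncomputable def sameHistory {n : ℕ} (i : ℕ) (σ₀ : Equiv.Perm (Fin n)) :
    Finset (Equiv.Perm (Fin n)) :=
  Finset.univ.filter fun σ => history i σ = history i σ₀

/-- The strategies for making at most `k` choices at times `i, i + 1, …, n`: vectors of stopping
times with respect to the relative ranks, at which candidates are chosen one after the other.
The value `⊤` means that the choice is not made. -/
structure IsAdmissible {n : ℕ} (k i : ℕ)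
    (τ : Fin k → Equiv.Perm (Fin n) → WithTop ℕ) : Prop where
  stopping : ∀ l, MeasureTheory.IsStoppingTime (rankFiltration n) (τ l)
  candidate : ∀ l σ (j : ℕ), τ l σ = (j : WithTop ℕ) → IsCandidate σ j
  start : ∀ l σ, (i : WithTop ℕ) ≤ τ l σ
  increasing : ∀ l l' σ, l < l' → τ l σ < τ l' σ ∨ (τ l σ = ⊤ ∧ τ l' σ = ⊤)

/-- The net payoff of one choice: its duration less the acquisition cost `c`; nothing is gained
or paid if the choice is not made. -/
noncomputable def netPayoff {n : ℕ} (c : ℝ) (σ : Equiv.Perm (Fin n)) : WithTop ℕ → ℝ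
  | ⊤ => 0
  | (j : ℕ) => duration σ j - c

/-- The total net payoff of a vector of choices. -/
noncomputable def totalPayoff {n k : ℕ} (c : ℝ)
    (τ : Fin k → Equiv.Perm (Fin n) → WithTop ℕ) (σ : Equiv.Perm (Fin n)) : ℝ :=
  ∑ l, netPayoff c σ (τ l σ)

/-- The first candidate at a time `j` with `lo ≤ j ≤ hi`, and `⊤` if there is none. -/
noncomputable def firstCandidate {n : ℕ} (σ : Equiv.Perm (Fin n)) (lo hi : ℕ) : WithTop ℕ :=
  sInf {x : WithTop ℕ | ∃ j : ℕ, x = (j : WithTop ℕ) ∧ lo ≤ j ∧ j ≤ hi ∧ IsCandidate σ j}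

/-- The choices made from time `i` on, with `k` choices left, by the threshold strategy: whenever
`k` choices are left, choose the next candidate at or after time `s k` but no later than `b`. -/
noncomputable def thresholdTimes {n : ℕ} (s : ℕ → ℕ) (b : ℕ) (σ : Equiv.Perm (Fin n)) :
    (k : ℕ) → (i : ℕ) → Fin k → WithTop ℕ
  | 0, _ => Fin.elim0
  | k + 1, i =>
    Fin.cons (firstCandidate σ (max i (s (k + 1))) b)
      (match firstCandidate σ (max i (s (k + 1))) b with
        | ⊤ => fun _ => ⊤
        | (j : ℕ) => thresholdTimes s b σ k (j + 1))

/-- The threshold strategy as a vector of random times. -/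
noncomputable def thresholdStrategy {n : ℕ} (s : ℕ → ℕ) (b k i : ℕ) :
    Fin k → Equiv.Perm (Fin n) → WithTop ℕ :=
  fun l σ => thresholdTimes s b σ k i l

/-- `K(n) = min {i ≥ 1 : H_n - H_i ≤ 1}`, with `H` the harmonic numbers. -/
noncomputable def peakTime (n : ℕ) : ℕ :=
  sInf {i : ℕ | 1 ≤ i ∧ (harmonic n : ℝ) - (harmonic i : ℝ) ≤ 1}

/-- `a(n, c)`: the first time at which choosing a candidate has nonnegative mean net payoff. -/
noncomputable def firstTime (n : ℕ) (c : ℝ) : ℕ :=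
  sInf {i : ℕ | 1 ≤ i ∧ i ≤ n ∧ 0 ≤ meanDuration n i - c}

/-- `b(n, c)`: the last time at which choosing a candidate has nonnegative mean net payoff. -/
noncomputable def lastTime (n : ℕ) (c : ℝ) : ℕ :=
  sSup {i : ℕ | 1 ≤ i ∧ i ≤ n ∧ 0 ≤ meanDuration n i - c}

/-- `G^{(k)}_i` for `1 ≤ i ≤ N` and `k ≥ 1`, from `G^{(1)}` and the numbers `s_1, s_2, …`. (The
value at `k = 0` is a dummy.) -/
noncomputable def gain (N : ℕ) (G₁ : ℕ → ℝ) (s : ℕ → ℕ) : ℕ → ℕ → ℝ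
  | 0, _ => 0
  | 1, i => G₁ i
  | k + 2, i =>
    G₁ i + ∑ j ∈ Finset.Icc (max (i + 1) (s (k + 1))) N, 1 / ((j : ℝ) - 1) * gain N G₁ s (k + 1) j

/-- `s_1, …, s_m` are the critical numbers generated by `G^{(1)}` on `{1, …, N}`. -/
structure IsCriticalSequence (N m : ℕ) (G₁ : ℕ → ℝ) (s : ℕ → ℕ) : Prop where
  nonneg_succ : ∀ k, 1 ≤ k → k ≤ m → ∀ i, 1 ≤ i → i < N →
    0 ≤ gain N G₁ s k i → 0 ≤ gain N G₁ s k (i + 1)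
  le_next : ∀ k, 1 ≤ k → k < m → ∀ i, 1 ≤ i → i ≤ N → gain N G₁ s k i ≤ gain N G₁ s (k + 1) i
  le_succ : ∀ k, 1 ≤ k → k ≤ m → ∀ i, 1 ≤ i → i < s k → gain N G₁ s k i ≤ gain N G₁ s k (i + 1)
  isLeast : ∀ k, 1 ≤ k → k ≤ m → IsLeast {i : ℕ | 1 ≤ i ∧ i ≤ N ∧ 0 ≤ gain N G₁ s k i} (s k)

/-- `G^{(1)}_i` for the duration problem with acquisition cost `c`, where `b = b(n, c)`. -/
noncomputable def acquisitionGain (n : ℕ) (c : ℝ) (i : ℕ) : ℝ :=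
  (harmonic n : ℝ) - (harmonic (i - 1) : ℝ)
    - ∑ j ∈ Finset.Icc (i + 1) (lastTime n c),
        1 / ((j : ℝ) - 1) * ((harmonic n : ℝ) - (harmonic (j - 1) : ℝ))
    - c / (lastTime n c : ℝ)

end DurationProblem

open DurationProblem

namespace DurationProblem

open Finset

/-! ### Relative ranks as independent uniform coordinates of a ranking. -/

section Counting

variable {n : ℕ}

/-! The relative ranks encode a ranking bijectively (`rankCode_bijective`), so, given the
observations up to time i, the next object is a candidate with probability 1/(i+1)
(`card_candidate_mul`). Backward induction then gives U_i = i (H_n - H_{i-1}), with increments H_n -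
H_i - 1. Hence U rises up to K(n) and does not rise after it, and {U ≥ c} is an interval. The
increments of G^{(1)} are (H_n - H_i - 1)/i, of the same sign, and G^{(1)}_b = (U_b - c)/b ≥ 0. So
G^{(1)} is monotone up to K(n) and nonnegative from there to b. Induction on k turns this into a
single change of sign of each G^{(k)} (`CriticalProperties.succ`).

Optimality is dynamic programming. Let V_k(i) be the sum of G^{(k)}_j over max(i, s_k) ≤ j ≤ b, and
let A_i = U_i - c + V_{k-1}(i+1) - V_k(i+1) be the advantage of selecting a candidate at time i over
passing it, with k choices left. For s_k - 1 ≤ i ≤ b it equals i G^{(k)}_i (`advantage_eq`); it is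
nonnegative for s_k ≤ i ≤ b and nonpositive at all other times. Therefore V_k(i) = V_k(i+1) + max(0,
A_i)/i, which is the Bellman equation (`value_succ_eq`). Backward induction over classes of equal
observations bounds every strategy by this value (`sum_totalPayoff_le`) and shows that the threshold
strategy attains it (`sum_totalPayoff_thresholdStrategy`). -/

lemma relRank_pos (σ : Equiv.Perm (Fin n)) (t : Fin n) : 0 < relRank σ t :=
  Finset.card_pos.2 ⟨t, by simp⟩

lemma relRank_le (σ : Equiv.Perm (Fin n)) (t : Fin n) : relRank σ t ≤ t + 1 := by
  calc relRank σ t ≤ (Finset.Iic t).card :=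
        Finset.card_le_card fun u hu => by simpa using (Finset.mem_filter.1 hu).2.1
    _ = t + 1 := Fin.card_Iic t

/-- Counting by ranks instead of times: the set of ranks used up to time t can be compared between
two rankings. -/
lemma relRank_eq_card (σ : Equiv.Perm (Fin n)) (t : Fin n) :
    relRank σ t = (Finset.univ.filter fun y : Fin n => σ.symm y ≤ t ∧ y ≤ σ t).card := by
  refine Finset.card_bij (fun u _ => σ u) ?_ ?_ ?_
  · intro u hu
    simpa using hu
  · intro u _ v _ h
    exact σ.injective h
  · intro y hy
    exact ⟨σ.symm y, by simpa using hy, by simp⟩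

/-- The relative ranks determine the ranking. -/
lemma eq_of_relRank_eq {σ σ' : Equiv.Perm (Fin n)} (h : ∀ t, relRank σ t = relRank σ' t) :
    σ = σ' := by
  -- If the same ranks are used up to time t, a larger rank at t counts strictly more of them.
  have key : ∀ ρ ρ' : Equiv.Perm (Fin n), ∀ t, relRank ρ t = relRank ρ' t →
      (∀ y, ρ.symm y ≤ t ↔ ρ'.symm y ≤ t) → ¬ ρ t < ρ' t := by
    intro ρ ρ' t hr hy hlt
    rw [relRank_eq_card, relRank_eq_card] at hr
    refine absurd hr (Finset.card_lt_card ?_).ne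
    refine (Finset.ssubset_iff_of_subset ?_).2 ⟨ρ' t, ?_, ?_⟩
    · intro y
      simp only [Finset.mem_filter, Finset.mem_univ, true_and, hy]
      exact fun hh => ⟨hh.1, hh.2.trans hlt.le⟩
    · simp
    · simp [hlt]
  ext1 t
  -- Downward in time: agreement after t means that the same set of ranks is left for the times up
  -- to t.
  induction t using WellFoundedGT.induction with
  | ind t ih =>
    have hy : ∀ y, σ.symm y ≤ t ↔ σ'.symm y ≤ t := by
      intro y
      constructor
      · intro hle
        by_contra! hlt
        have := ih _ hlt
        rw [Equiv.apply_symm_apply] at this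
        rw [← this, Equiv.symm_apply_apply] at hle
        exact absurd hle (not_le.2 hlt)
      · intro hle
        by_contra! hlt
        have := ih _ hlt
        rw [Equiv.apply_symm_apply] at this
        rw [this, Equiv.symm_apply_apply] at hle
        exact absurd hle (not_le.2 hlt)
    exact le_antisymm (not_lt.1 (key σ' σ t (h t).symm fun y => (hy y).symm))
      (not_lt.1 (key σ σ' t (h t) hy))

/-- The vector of relative ranks, shifted so as to start from `0`. -/
def rankCode (σ : Equiv.Perm (Fin n)) (t : Fin n) : Fin (t + 1) :=
  ⟨relRank σ t - 1, by have := relRank_pos σ t; have := relRank_le σ t; omega⟩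

lemma rankCode_eq_iff {σ σ' : Equiv.Perm (Fin n)} {t : Fin n} :
    rankCode σ t = rankCode σ' t ↔ relRank σ t = relRank σ' t := by
  have := relRank_pos σ t
  have := relRank_pos σ' t
  simp only [rankCode, Fin.mk.injEq]
  omega

/-- Injectivity suffices, as both sides have n! = ∏ (t + 1) elements. -/
lemma rankCode_bijective :
    Function.Bijective (rankCode : Equiv.Perm (Fin n) → ∀ t : Fin n, Fin (t + 1)) := by
  rw [Fintype.bijective_iff_injective_and_card]
  refine ⟨fun σ σ' h => eq_of_relRank_eq fun t => rankCode_eq_iff.1 (congrFun h t), ?_⟩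
  rw [Fintype.card_perm, Fintype.card_pi, Fintype.card_fin]
  simp only [Fintype.card_fin]
  rw [Fin.prod_univ_eq_prod_range (fun i => i + 1) n, Finset.prod_range_add_one_eq_factorial]

lemma isCandidate_succ {i : ℕ} (hi : i < n) (σ : Equiv.Perm (Fin n)) :
    IsCandidate σ (i + 1) ↔ rankCode σ ⟨i, hi⟩ = 0 := by
  have hp := relRank_pos σ ⟨i, hi⟩
  constructor
  · rintro ⟨t, ht, hr⟩
    obtain rfl : t = ⟨i, hi⟩ := Fin.ext (by simpa using ht)
    simp [rankCode, hr]
  · intro h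
    refine ⟨⟨i, hi⟩, rfl, ?_⟩
    have : relRank σ ⟨i, hi⟩ - 1 = 0 := by simpa [rankCode, Fin.ext_iff] using h
    omega

lemma IsCandidate.bounds {σ : Equiv.Perm (Fin n)} {i : ℕ} (h : IsCandidate σ i) :
    1 ≤ i ∧ i ≤ n := by
  obtain ⟨t, rfl, -⟩ := h
  have := t.2
  omega

lemma history_eq_iff {i : ℕ} {σ σ' : Equiv.Perm (Fin n)} :
    history i σ = history i σ' ↔ ∀ t : Fin n, (t : ℕ) < i → relRank σ t = relRank σ' t :=
  ⟨fun h t ht => congrFun h ⟨t, ht⟩, fun h => funext fun t => h t.1 t.2⟩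

lemma history_eq_mono {i j : ℕ} (hij : i ≤ j) {σ σ' : Equiv.Perm (Fin n)}
    (h : history j σ = history j σ') : history i σ = history i σ' :=
  history_eq_iff.2 fun t ht => history_eq_iff.1 h t (ht.trans_le hij)

lemma isCandidate_congr {i j : ℕ} (hij : i ≤ j) {σ σ' : Equiv.Perm (Fin n)}
    (h : history j σ = history j σ') : IsCandidate σ i ↔ IsCandidate σ' i := by
  unfold IsCandidate
  refine exists_congr fun t => and_congr_right fun ht => ?_
  rw [history_eq_iff.1 h t (by omega)]

lemma mem_sameHistory {i : ℕ} {σ σ₀ : Equiv.Perm (Fin n)} :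
    σ ∈ sameHistory i σ₀ ↔ history i σ = history i σ₀ := by
  simp [sameHistory]

lemma self_mem_sameHistory (i : ℕ) (σ₀ : Equiv.Perm (Fin n)) : σ₀ ∈ sameHistory i σ₀ :=
  mem_sameHistory.2 rfl

lemma sameHistory_subset {i j : ℕ} (hij : i ≤ j) {σ σ₀ : Equiv.Perm (Fin n)}
    (h : σ ∈ sameHistory i σ₀) : sameHistory j σ ⊆ sameHistory i σ₀ := fun _ hρ =>
  mem_sameHistory.2 ((history_eq_mono hij (mem_sameHistory.1 hρ)).trans (mem_sameHistory.1 h))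

/-- The first relative rank is always 1, so conditioning at time 1 is vacuous. -/
lemma sameHistory_one (σ₀ : Equiv.Perm (Fin n)) : sameHistory 1 σ₀ = Finset.univ := by
  refine Finset.eq_univ_iff_forall.2 fun σ => mem_sameHistory.2 (history_eq_iff.2 fun t ht => ?_)
  have := relRank_pos σ t
  have := relRank_pos σ₀ t
  have := relRank_le σ t
  have := relRank_le σ₀ t
  omega

open Classical in
/-- Given the observations up to time `i`, the object presented at time `i + 1` is a candidate
with probability `1 / (i + 1)`. -/
lemma card_candidate_mul {i : ℕ} (hi : i < n) (σ₀ : Equiv.Perm (Fin n)) :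
    ((sameHistory i σ₀).filter fun σ => IsCandidate σ (i + 1)).card * (i + 1)
      = (sameHistory i σ₀).card := by
  let e := Equiv.ofBijective _ (rankCode_bijective (n := n))
  let p : Fin n := ⟨i, hi⟩
  have he : ∀ f t, rankCode (e.symm f) t = f t := fun f t =>
    congrFun (e.apply_symm_apply f) t
  have hm : ∀ σ, σ ∈ sameHistory i σ₀ ↔ ∀ t : Fin n, (t : ℕ) < i → rankCode σ t = rankCode σ₀ t :=
    fun σ => by simp only [mem_sameHistory, history_eq_iff, rankCode_eq_iff]
  -- Overwriting the coordinate at p of the code keeps the earlier observations, so all i + 1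
  -- possible values of that coordinate occur equally often.
  have hcard : ∀ r : Fin (p + 1), ((sameHistory i σ₀).filter fun σ => rankCode σ p = r).card
      = ((sameHistory i σ₀).filter fun σ => IsCandidate σ (i + 1)).card := by
    intro r
    have hmem : ∀ (σ) (q : Fin (p + 1)), σ ∈ sameHistory i σ₀ →
        e.symm (Function.update (rankCode σ) p q) ∈ sameHistory i σ₀ := by
      intro σ q hσ
      rw [hm] at hσ ⊢
      intro t ht
      rw [he, Function.update_of_ne, hσ t ht]
      rintro rfl
      exact lt_irrefl _ ht
    have hinv : ∀ (σ) (q r : Fin (p + 1)), rankCode σ p = r →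
        e.symm (Function.update (rankCode (e.symm (Function.update (rankCode σ) p q))) p r)
          = σ := by
      rintro σ q _ rfl
      rw [Equiv.symm_apply_eq]
      funext t
      by_cases ht : t = p
      · subst ht
        simp [e]
      · rw [Function.update_of_ne ht, he, Function.update_of_ne ht]
        rfl
    refine Finset.card_bij' (fun σ _ => e.symm (Function.update (rankCode σ) p 0))
      (fun σ _ => e.symm (Function.update (rankCode σ) p r)) ?_ ?_ ?_ ?_
    · intro σ hσ
      rw [Finset.mem_filter] at hσ ⊢
      refine ⟨hmem σ _ hσ.1, ?_⟩
      rw [isCandidate_succ hi, he]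
      exact Function.update_self ..
    · intro σ hσ
      rw [Finset.mem_filter] at hσ ⊢
      refine ⟨hmem σ _ hσ.1, ?_⟩
      rw [he]
      exact Function.update_self ..
    · intro σ hσ
      exact hinv σ _ _ (Finset.mem_filter.1 hσ).2
    · intro σ hσ
      exact hinv σ _ _ ((isCandidate_succ hi σ).1 (Finset.mem_filter.1 hσ).2)
  rw [Finset.card_eq_sum_card_fiberwise (s := sameHistory i σ₀) (f := fun σ => rankCode σ p) (t := Finset.univ)
    (fun _ _ => Finset.mem_coe.2 (Finset.mem_univ _)), Finset.sum_congr rfl fun r _ => hcard r]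
  simp [p, mul_comm]

open Classical in
lemma sum_ite_candidate {i : ℕ} (hi : i < n) (σ₀ : Equiv.Perm (Fin n)) (x y : ℝ) :
    ∑ σ ∈ sameHistory i σ₀, (if IsCandidate σ (i + 1) then x else y)
      = (sameHistory i σ₀).card * (y + 1 / ((i : ℝ) + 1) * (x - y)) := by
  have h := card_candidate_mul hi σ₀
  have h' : (((sameHistory i σ₀).filter fun σ => IsCandidate σ (i + 1)).card : ℝ) * ((i : ℝ) + 1)
      = (sameHistory i σ₀).card := by exact_mod_cast h
  have hs : ∀ σ ∈ sameHistory i σ₀, (if IsCandidate σ (i + 1) then x else y)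
      = y + (if IsCandidate σ (i + 1) then x - y else 0) := by
    intro σ _
    split_ifs <;> ring
  rw [Finset.sum_congr rfl hs, Finset.sum_add_distrib, ← Finset.sum_filter]
  simp only [Finset.sum_const, nsmul_eq_mul]
  rw [← h']
  have : (i : ℝ) + 1 ≠ 0 := by positivity
  field_simp

/-- Sums over a union of classes of rankings can be compared class by class. -/
lemma sum_le_sum_of_sameHistory {j : ℕ} {S : Finset (Equiv.Perm (Fin n))}
    {f g : Equiv.Perm (Fin n) → ℝ} (hS : ∀ σ ∈ S, sameHistory j σ ⊆ S)
    (h : ∀ σ ∈ S, ∑ ρ ∈ sameHistory j σ, f ρ ≤ ∑ ρ ∈ sameHistory j σ, g ρ) :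
    ∑ σ ∈ S, f σ ≤ ∑ σ ∈ S, g σ := by
  classical
  have hmaps : ∀ σ ∈ S, history j σ ∈ S.image (history j) := fun σ hσ =>
    Finset.mem_image_of_mem _ hσ
  rw [← Finset.sum_fiberwise_of_maps_to hmaps, ← Finset.sum_fiberwise_of_maps_to hmaps]
  refine Finset.sum_le_sum fun x hx => ?_
  obtain ⟨σ, hσ, rfl⟩ := Finset.mem_image.1 hx
  have : S.filter (fun ρ => history j ρ = history j σ) = sameHistory j σ := by
    ext ρ
    rw [Finset.mem_filter, mem_sameHistory]
    exact ⟨fun hh => hh.2, fun hh => ⟨hS σ hσ (mem_sameHistory.2 hh), hh⟩⟩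
  rw [this]
  exact h σ hσ

lemma sum_eq_sum_of_sameHistory {j : ℕ} {S : Finset (Equiv.Perm (Fin n))}
    {f g : Equiv.Perm (Fin n) → ℝ} (hS : ∀ σ ∈ S, sameHistory j σ ⊆ S)
    (h : ∀ σ ∈ S, ∑ ρ ∈ sameHistory j σ, f ρ = ∑ ρ ∈ sameHistory j σ, g ρ) :
    ∑ σ ∈ S, f σ = ∑ σ ∈ S, g σ :=
  le_antisymm (sum_le_sum_of_sameHistory hS fun σ hσ => (h σ hσ).le)
    (sum_le_sum_of_sameHistory hS fun σ hσ => (h σ hσ).ge)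

end Counting

/-! ### The mean duration of a candidate. -/

section Duration

variable {n : ℕ}

lemma nextCandidate_eq {σ : Equiv.Perm (Fin n)} {i : ℕ}
    (h : IsCandidate σ (i + 1) ∨ i + 1 = n + 1) : nextCandidate σ i = i + 1 := by
  refine le_antisymm (Nat.sInf_le ⟨Nat.lt_succ_self i, h⟩) ?_
  exact le_csInf ⟨i + 1, Nat.lt_succ_self i, h⟩ fun j hj => hj.1

lemma nextCandidate_succ {σ : Equiv.Perm (Fin n)} {i : ℕ}
    (h : ¬ IsCandidate σ (i + 1)) (hi : i < n) :
    nextCandidate σ i = nextCandidate σ (i + 1) := by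
  unfold nextCandidate
  congr 1
  ext j
  refine and_congr_left fun hj => ⟨fun hij => lt_of_le_of_ne hij ?_, fun hij => by omega⟩
  rintro rfl
  rcases hj with hj | hj
  · exact h hj
  · omega

/-- The mean duration of a candidate at time `i` is `i (H_n - H_{i-1})`. -/
noncomputable def meanDurationFormula (n i : ℕ) : ℝ :=
  i * ((harmonic n : ℝ) - (harmonic (i - 1) : ℝ))

lemma harmonic_succ_cast (i : ℕ) :
    (harmonic (i + 1) : ℝ) = harmonic i + 1 / ((i : ℝ) + 1) := by
  rw [harmonic_succ]
  push_cast
  rw [one_div]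

lemma meanDurationFormula_succ (n i : ℕ) :
    meanDurationFormula n (i + 1) = (i + 1) * ((harmonic n : ℝ) - harmonic i) := by
  simp [meanDurationFormula]

lemma meanDurationFormula_eq {i : ℕ} (hi : 1 ≤ i) :
    meanDurationFormula n i = 1 + i * ((harmonic n : ℝ) - harmonic i) := by
  obtain ⟨i, rfl⟩ := Nat.exists_eq_add_of_le' hi
  rw [meanDurationFormula_succ, harmonic_succ_cast]
  push_cast
  have : (i : ℝ) + 1 ≠ 0 := by positivity
  field_simp
  ring

/-- Given the observations up to time `i`, the mean time until the next candidate. -/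
lemma sum_duration {i : ℕ} (hi1 : 1 ≤ i) (hin : i ≤ n) (σ₀ : Equiv.Perm (Fin n)) :
    ∑ σ ∈ sameHistory i σ₀, duration σ i
      = (sameHistory i σ₀).card * meanDurationFormula n i := by
  classical
  induction hin using Nat.decreasingInduction generalizing σ₀ with
  | self =>
    have : ∀ σ ∈ sameHistory n σ₀, duration σ n = 1 := by
      intro σ _
      rw [duration, nextCandidate_eq (Or.inr rfl)]
      push_cast
      ring
    rw [Finset.sum_congr rfl this, meanDurationFormula_eq hi1]
    simp
  | of_succ i hlt ih =>
    have hlt : i < n := hlt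
    have hd : ∀ σ : Equiv.Perm (Fin n), duration σ i = 1 + (if IsCandidate σ (i + 1) then 0 else duration σ (i + 1)) := by
      intro σ
      split_ifs with h
      · rw [duration, nextCandidate_eq (Or.inl h)]
        push_cast
        ring
      · rw [duration, duration, nextCandidate_succ h hlt]
        push_cast
        ring
    -- Condition on one more observation: a candidate at i + 1 ends the duration at 1, and otherwise
    -- the mean time remaining after i + 1 is given by the induction hypothesis.
    have h1 : ∑ σ ∈ sameHistory i σ₀, duration σ i = ∑ σ ∈ sameHistory i σ₀,
        (if IsCandidate σ (i + 1) then (1 : ℝ) else 1 + meanDurationFormula n (i + 1)) := by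
      refine sum_eq_sum_of_sameHistory (j := i + 1)
        (fun σ hσ => sameHistory_subset (Nat.le_succ i) hσ) fun σ _ => ?_
      have hc : ∀ ρ ∈ sameHistory (i + 1) σ, (IsCandidate ρ (i + 1) ↔ IsCandidate σ (i + 1)) :=
        fun ρ hρ => isCandidate_congr le_rfl (mem_sameHistory.1 hρ)
      by_cases h : IsCandidate σ (i + 1)
      · refine Finset.sum_congr rfl fun ρ hρ => ?_
        rw [hd, if_pos ((hc ρ hρ).2 h), if_pos ((hc ρ hρ).2 h), add_zero]
      · have e1 : ∀ ρ ∈ sameHistory (i + 1) σ, duration ρ i = 1 + duration ρ (i + 1) := by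
          intro ρ hρ
          rw [hd, if_neg (mt (hc ρ hρ).1 h)]
        have e2 : ∀ ρ ∈ sameHistory (i + 1) σ,
            (if IsCandidate ρ (i + 1) then (1 : ℝ) else 1 + meanDurationFormula n (i + 1))
              = 1 + meanDurationFormula n (i + 1) := by
          intro ρ hρ
          rw [if_neg (mt (hc ρ hρ).1 h)]
        rw [Finset.sum_congr rfl e1, Finset.sum_congr rfl e2, Finset.sum_add_distrib,
          ih (by omega) σ]
        simp only [Finset.sum_const, nsmul_eq_mul]
        ring
    rw [h1, sum_ite_candidate hlt, meanDurationFormula_succ, meanDurationFormula_eq hi1]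
    have : (i : ℝ) + 1 ≠ 0 := by positivity
    field_simp
    ring

/-- Makes the conditioning event in `meanDuration` nonempty, so that the division there is by a
nonzero number. -/
lemma isCandidate_revPerm {i : ℕ} (hi1 : 1 ≤ i) (hin : i ≤ n) :
    IsCandidate (Fin.revPerm : Equiv.Perm (Fin n)) i := by
  refine ⟨⟨i - 1, by omega⟩, by simp; omega, ?_⟩
  rw [relRank, Finset.card_eq_one]
  refine ⟨⟨i - 1, by omega⟩, ?_⟩
  ext u
  simp only [Finset.mem_filter, Finset.mem_univ, true_and, Fin.revPerm_apply, Fin.rev_le_rev,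
    Finset.mem_singleton]
  exact ⟨fun h => le_antisymm h.1 h.2, fun h => ⟨h.le, h.ge⟩⟩

lemma meanDuration_eq {i : ℕ} (hi1 : 1 ≤ i) (hin : i ≤ n) :
    meanDuration n i = meanDurationFormula n i := by
  classical
  unfold meanDuration mean
  rw [div_eq_iff]
  · rw [mul_comm, ← nsmul_eq_mul, ← Finset.sum_const]
    refine sum_eq_sum_of_sameHistory (j := i) (fun σ hσ ρ hρ => ?_) fun σ _ => ?_
    · rw [Finset.mem_filter] at hσ ⊢
      exact ⟨Finset.mem_univ _, (isCandidate_congr le_rfl (mem_sameHistory.1 hρ)).2 hσ.2⟩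
    · rw [sum_duration hi1 hin, Finset.sum_const, nsmul_eq_mul]
  · refine Nat.cast_ne_zero.2 (Finset.card_pos.2 ⟨Fin.revPerm, ?_⟩).ne'
    exact Finset.mem_filter.2 ⟨Finset.mem_univ _, isCandidate_revPerm hi1 hin⟩

end Duration

/-! ### Critical numbers generated by an abstract function with one change of sign. -/

section CriticalNumbers

lemma sum_Icc_eq_add_sum_Icc_succ {i N : ℕ} (hi : i ≤ N) (f : ℕ → ℝ) :
    ∑ j ∈ Finset.Icc i N, f j = f i + ∑ j ∈ Finset.Icc (i + 1) N, f j := by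
  have h : Finset.Icc i N = insert i (Finset.Icc (i + 1) N) := by
    ext j
    simp only [Finset.mem_insert, Finset.mem_Icc]
    omega
  rw [h, Finset.sum_insert (by simp)]

lemma sum_Icc_max {N i s : ℕ} (hi : i ≤ N) (f : ℕ → ℝ) :
    ∑ j ∈ Finset.Icc (max i s) N, f j
      = (if s ≤ i then f i else 0) + ∑ j ∈ Finset.Icc (max (i + 1) s) N, f j := by
  split_ifs with h
  · rw [max_eq_left h, max_eq_left (h.trans (Nat.le_succ i)), sum_Icc_eq_add_sum_Icc_succ hi]
  · rw [max_eq_right (by omega), max_eq_right (by omega), zero_add]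

/-- The functions `G^{(k)}`, with the critical numbers computed along the way. -/
noncomputable def iteratedGain (N : ℕ) (G₁ : ℕ → ℝ) : ℕ → ℕ → ℝ
  | 0 => fun _ => 0
  | 1 => G₁
  | k + 2 => fun i => G₁ i + ∑ j ∈ Finset.Icc (max (i + 1)
      (sInf {i : ℕ | 1 ≤ i ∧ i ≤ N ∧ 0 ≤ iteratedGain N G₁ (k + 1) i})) N,
        1 / ((j : ℝ) - 1) * iteratedGain N G₁ (k + 1) j

/-- The critical numbers generated by `G₁`. -/
noncomputable def criticalNumber (N : ℕ) (G₁ : ℕ → ℝ) (k : ℕ) : ℕ :=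
  sInf {i : ℕ | 1 ≤ i ∧ i ≤ N ∧ 0 ≤ iteratedGain N G₁ k i}

/-- `gain` needs the critical numbers and these are defined through `gain`; the recursion
`iteratedGain` resolves the circularity. -/
lemma gain_criticalNumber (N : ℕ) (G₁ : ℕ → ℝ) (k i : ℕ) :
    gain N G₁ (criticalNumber N G₁) k i = iteratedGain N G₁ k i := by
  induction k generalizing i with
  | zero => simp [gain, iteratedGain]
  | succ k ih =>
    cases k with
    | zero => simp [gain, iteratedGain]
    | succ k => simp only [gain, iteratedGain, ih, criticalNumber]

lemma criticalNumber_eq (N : ℕ) (G₁ : ℕ → ℝ) (k : ℕ) :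
    criticalNumber N G₁ k
      = sInf {i : ℕ | 1 ≤ i ∧ i ≤ N ∧ 0 ≤ gain N G₁ (criticalNumber N G₁) k i} := by
  simp only [gain_criticalNumber]
  rfl

lemma gain_of_le {N : ℕ} {G₁ : ℕ → ℝ} {s : ℕ → ℕ} {k i : ℕ} (hk : 1 ≤ k) (hi : N ≤ i) :
    gain N G₁ s k i = G₁ i := by
  obtain ⟨k, rfl⟩ := Nat.exists_eq_add_of_le' hk
  cases k with
  | zero => rfl
  | succ k =>
    rw [gain, Finset.Icc_eq_empty (by simp only [max_le_iff]; omega),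
      Finset.sum_empty, add_zero]

/-- What is shown by induction on the number of choices about the critical numbers. -/
structure CriticalProperties (N K : ℕ) (G₁ : ℕ → ℝ) (s : ℕ → ℕ) (k : ℕ) : Prop where
  isLeast : IsLeast {i : ℕ | 1 ≤ i ∧ i ≤ N ∧ 0 ≤ gain N G₁ s k i} (s k)
  nonneg : ∀ i, s k ≤ i → i ≤ N → 0 ≤ gain N G₁ s k i
  le_succ : ∀ i, 1 ≤ i → i < s k → gain N G₁ s k i ≤ gain N G₁ s k (i + 1)
  -- Keeps the times below s_k in the range where G₁ is monotone, as the next induction step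
  -- requires.
  le_peak : s k ≤ K
  le_next : ∀ i, 1 ≤ i → i ≤ N → gain N G₁ s k i ≤ gain N G₁ s (k + 1) i

variable {N K : ℕ} {G₁ : ℕ → ℝ} {s : ℕ → ℕ}

lemma CriticalProperties.neg {k i : ℕ} (h : CriticalProperties N K G₁ s k) (hi : 1 ≤ i)
    (his : i < s k) : gain N G₁ s k i < 0 := by
  by_contra! h0
  exact absurd (h.isLeast.2 ⟨hi, his.le.trans h.isLeast.1.2.1, h0⟩) (not_le.2 his)

lemma CriticalProperties.succ_le {k : ℕ} (h : CriticalProperties N K G₁ s k)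
    (h' : CriticalProperties N K G₁ s (k + 1)) : s (k + 1) ≤ s k := by
  obtain ⟨h1, h2, h3⟩ := h.isLeast.1
  exact h'.isLeast.2 ⟨h1, h2, h3.trans (h.le_next _ h1 h2)⟩

lemma one_div_sub_one_nonneg {i j : ℕ} (hi : 1 ≤ i) (hj : i + 1 ≤ j) :
    0 ≤ 1 / ((j : ℝ) - 1) := by
  have : (1 : ℝ) ≤ j := by exact_mod_cast (by omega : 1 ≤ j)
  exact one_div_nonneg.2 (by linarith)

lemma criticalProperties_one (hs : ∀ k, s k = sInf {i : ℕ | 1 ≤ i ∧ i ≤ N ∧ 0 ≤ gain N G₁ s k i})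
    (hK : 1 ≤ K) (hKN : K ≤ N) (hmono : ∀ i, 1 ≤ i → i < K → G₁ i ≤ G₁ (i + 1))
    (hnn : ∀ i, K ≤ i → i ≤ N → 0 ≤ G₁ i) : CriticalProperties N K G₁ s 1 := by
  have hmono' : ∀ i j, 1 ≤ i → i ≤ j → j ≤ K → G₁ i ≤ G₁ j := by
    intro i j hi hij
    induction j, hij using Nat.le_induction with
    | base => exact fun _ => le_rfl
    | succ j hij ih => exact fun hj => (ih (by omega)).trans (hmono j (by omega) (by omega))
  have hleast : IsLeast {i : ℕ | 1 ≤ i ∧ i ≤ N ∧ 0 ≤ gain N G₁ s 1 i} (s 1) := by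
    rw [hs 1]
    exact ⟨Nat.sInf_mem ⟨K, hK, hKN, hnn K le_rfl hKN⟩, fun i hi => Nat.sInf_le hi⟩
  have hle : s 1 ≤ K := hleast.2 ⟨hK, hKN, hnn K le_rfl hKN⟩
  have hge : ∀ i, s 1 ≤ i → i ≤ N → 0 ≤ G₁ i := by
    intro i hi hiN
    rcases le_total K i with h | h
    · exact hnn i h hiN
    · exact hleast.1.2.2.trans (hmono' _ _ hleast.1.1 hi h)
  refine ⟨hleast, hge, fun i hi his => hmono i hi (by omega), hle, fun i hi hiN => ?_⟩
  simp only [gain, le_add_iff_nonneg_right]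
  refine Finset.sum_nonneg fun j hj => ?_
  simp only [Finset.mem_Icc, max_le_iff] at hj
  exact mul_nonneg (one_div_sub_one_nonneg hi hj.1.1) (hge j hj.1.2 hj.2)

/-- From s_k on, G^{(k+1)} ≥ G^{(k)} ≥ 0. Well below s_k the sum in G^{(k+1)} always starts at s_k,
so it is constant and G^{(k+1)} inherits the monotonicity of G₁. -/
lemma CriticalProperties.succ {k : ℕ} (hk : 1 ≤ k) (h : CriticalProperties N K G₁ s k)
    (hs : ∀ k, s k = sInf {i : ℕ | 1 ≤ i ∧ i ≤ N ∧ 0 ≤ gain N G₁ s k i})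
    (hmono : ∀ i, 1 ≤ i → i < K → G₁ i ≤ G₁ (i + 1)) :
    CriticalProperties N K G₁ s (k + 1) := by
  obtain ⟨k, rfl⟩ := Nat.exists_eq_add_of_le' hk
  have hmem := h.isLeast.1
  have hsk : s (k + 1) ∈ {i : ℕ | 1 ≤ i ∧ i ≤ N ∧ 0 ≤ gain N G₁ s (k + 1 + 1) i} :=
    ⟨hmem.1, hmem.2.1, hmem.2.2.trans (h.le_next _ hmem.1 hmem.2.1)⟩
  have hleast : IsLeast {i : ℕ | 1 ≤ i ∧ i ≤ N ∧ 0 ≤ gain N G₁ s (k + 1 + 1) i}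
      (s (k + 1 + 1)) := by
    rw [hs (k + 1 + 1)]
    exact ⟨Nat.sInf_mem ⟨_, hsk⟩, fun i hi => Nat.sInf_le hi⟩
  have hle : s (k + 1 + 1) ≤ s (k + 1) := hleast.2 hsk
  have hpos : ∀ i, s (k + 1) ≤ i → i ≤ N → 0 ≤ gain N G₁ s (k + 1 + 1) i := fun i hi hiN =>
    (h.nonneg i hi hiN).trans (h.le_next i (hmem.1.trans hi) hiN)
  have hinc : ∀ i, 1 ≤ i → i + 1 < s (k + 1) →
      gain N G₁ s (k + 1 + 1) i ≤ gain N G₁ s (k + 1 + 1) (i + 1) := by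
    intro i hi hlt
    have hp := h.le_peak
    simp only [gain]
    rw [max_eq_right hlt.le, max_eq_right (by omega : i + 1 + 1 ≤ s (k + 1))]
    exact add_le_add_left (hmono i hi (by omega)) _
  have hge : ∀ i, s (k + 1 + 1) ≤ i → i ≤ N → 0 ≤ gain N G₁ s (k + 1 + 1) i := by
    intro i hi
    induction i, hi using Nat.le_induction with
    | base => exact fun _ => hleast.1.2.2
    | succ i hi ih =>
      intro hiN
      by_cases hlt : i + 1 < s (k + 1)
      · exact (ih (by omega)).trans (hinc i (hleast.1.1.trans hi) hlt)
      · exact hpos _ (not_lt.1 hlt) hiN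
  refine ⟨hleast, hge, fun i hi his => ?_, hle.trans h.le_peak, fun i hi hiN => ?_⟩
  · by_cases hlt : i + 1 < s (k + 1)
    · exact hinc i hi hlt
    -- Here i + 1 equals the previous critical number and the sum changes between i and i + 1; the
    -- signs alone give the inequality.
    · have hneg : gain N G₁ s (k + 1 + 1) i < 0 := by
        by_contra! h0
        exact absurd (hleast.2 ⟨hi, his.le.trans hleast.1.2.1, h0⟩) (not_le.2 his)
      exact hneg.le.trans (hpos _ (not_lt.1 hlt) (his.trans_le hleast.1.2.1))
  · simp only [gain]
    refine add_le_add_right ?_ _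
    -- One more choice enlarges each summand and then extends the range by nonnegative terms.
    calc ∑ j ∈ Finset.Icc (max (i + 1) (s (k + 1))) N,
            1 / ((j : ℝ) - 1) * gain N G₁ s (k + 1) j
        ≤ ∑ j ∈ Finset.Icc (max (i + 1) (s (k + 1))) N,
            1 / ((j : ℝ) - 1) * gain N G₁ s (k + 1 + 1) j := by
          refine Finset.sum_le_sum fun j hj => ?_
          simp only [Finset.mem_Icc, max_le_iff] at hj
          exact mul_le_mul_of_nonneg_left (h.le_next j (by omega) hj.2)
            (one_div_sub_one_nonneg hi hj.1.1)
      _ ≤ _ := by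
          refine Finset.sum_le_sum_of_subset_of_nonneg
            (Finset.Icc_subset_Icc_left (max_le_max le_rfl hle)) fun j hj _ => ?_
          simp only [Finset.mem_Icc, max_le_iff] at hj
          exact mul_nonneg (one_div_sub_one_nonneg hi hj.1.1) (hge j hj.1.2 hj.2)

lemma criticalProperties (hs : ∀ k, s k = sInf {i : ℕ | 1 ≤ i ∧ i ≤ N ∧ 0 ≤ gain N G₁ s k i})
    (hK : 1 ≤ K) (hKN : K ≤ N) (hmono : ∀ i, 1 ≤ i → i < K → G₁ i ≤ G₁ (i + 1))
    (hnn : ∀ i, K ≤ i → i ≤ N → 0 ≤ G₁ i) {k : ℕ} (hk : 1 ≤ k) :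
    CriticalProperties N K G₁ s k := by
  induction k, hk using Nat.le_induction with
  | base => exact criticalProperties_one hs hK hKN hmono hnn
  | succ k hk ih => exact ih.succ hk hs hmono

lemma antitoneOn_of_criticalProperties (h : ∀ k, 1 ≤ k → CriticalProperties N K G₁ s k) (m : ℕ) :
    AntitoneOn s (Set.Icc 1 m) := by
  intro k hk l _ hkl
  induction l, hkl using Nat.le_induction with
  | base => exact le_rfl
  | succ l hkl ih =>
    have hl : 1 ≤ l := hk.1.trans hkl
    exact ((h l hl).succ_le (h (l + 1) (by omega))).trans (ih ⟨hl, by simp_all; omega⟩)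

lemma isCriticalSequence_of_criticalProperties
    (h : ∀ k, 1 ≤ k → CriticalProperties N K G₁ s k) (m : ℕ) :
    IsCriticalSequence N m G₁ s where
  nonneg_succ k hk _ i hi hiN h0 :=
    (h k hk).nonneg _ (((h k hk).isLeast.2 ⟨hi, hiN.le, h0⟩).trans (Nat.le_succ i)) hiN
  le_next k hk _ i hi hiN := (h k hk).le_next i hi hiN
  le_succ k hk _ i hi his := (h k hk).le_succ i hi his
  isLeast k hk _ := (h k hk).isLeast

end CriticalNumbers

/-! ### Unimodality of the mean duration, and the increments of G^{(1)}. -/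

section Peak

variable {n : ℕ}

lemma harmonic_cast_mono {i j : ℕ} (hij : i ≤ j) : (harmonic i : ℝ) ≤ harmonic j := by
  induction j, hij using Nat.le_induction with
  | base => exact le_rfl
  | succ j _ ih =>
    rw [harmonic_succ_cast]
    have : (0 : ℝ) ≤ 1 / ((j : ℝ) + 1) := by positivity
    linarith

lemma peakTime_isLeast (hn : 1 ≤ n) :
    IsLeast {i : ℕ | 1 ≤ i ∧ (harmonic n : ℝ) - (harmonic i : ℝ) ≤ 1} (peakTime n) :=
  ⟨Nat.sInf_mem ⟨n, hn, by simp⟩, fun _ hi => Nat.sInf_le hi⟩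

lemma peakTime_le (hn : 1 ≤ n) : peakTime n ≤ n :=
  (peakTime_isLeast hn).2 ⟨hn, by simp⟩

lemma one_lt_of_lt_peakTime (hn : 1 ≤ n) {i : ℕ} (hi : 1 ≤ i) (hlt : i < peakTime n) :
    1 < (harmonic n : ℝ) - harmonic i := by
  by_contra! h
  exact absurd ((peakTime_isLeast hn).2 ⟨hi, h⟩) (not_le.2 hlt)

lemma le_one_of_peakTime_le (hn : 1 ≤ n) {i : ℕ} (hle : peakTime n ≤ i) :
    (harmonic n : ℝ) - harmonic i ≤ 1 := by
  have := (peakTime_isLeast hn).1.2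
  have := harmonic_cast_mono hle
  linarith

/-- The increment changes sign exactly where K(n) is defined; unimodality follows. -/
lemma meanDurationFormula_succ_sub {i : ℕ} (hi : 1 ≤ i) :
    meanDurationFormula n (i + 1)
      = meanDurationFormula n i + ((harmonic n : ℝ) - harmonic i - 1) := by
  rw [meanDurationFormula_succ, meanDurationFormula_eq hi]
  ring

lemma meanDurationFormula_mono (hn : 1 ≤ n) {i j : ℕ} (hi : 1 ≤ i) (hij : i ≤ j)
    (hj : j ≤ peakTime n) : meanDurationFormula n i ≤ meanDurationFormula n j := by
  induction j, hij using Nat.le_induction with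
  | base => exact le_rfl
  | succ j hij ih =>
    have := one_lt_of_lt_peakTime hn (hi.trans hij) hj
    rw [meanDurationFormula_succ_sub (hi.trans hij)]
    linarith [ih (by omega)]

lemma meanDurationFormula_anti (hn : 1 ≤ n) {i j : ℕ} (hi : peakTime n ≤ i) (hij : i ≤ j) :
    meanDurationFormula n j ≤ meanDurationFormula n i := by
  induction j, hij using Nat.le_induction with
  | base => exact le_rfl
  | succ j hij ih =>
    have := le_one_of_peakTime_le hn (hi.trans hij)
    have := (peakTime_isLeast hn).1.1
    rw [meanDurationFormula_succ_sub (by omega)]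
    linarith

variable {c : ℝ}

lemma peakTime_mem (hn : 1 ≤ n) (hcU : c < meanDuration n (peakTime n)) :
    peakTime n ∈ {i : ℕ | 1 ≤ i ∧ i ≤ n ∧ 0 ≤ meanDuration n i - c} :=
  ⟨(peakTime_isLeast hn).1.1, peakTime_le hn, by linarith⟩

lemma firstTime_isLeast (hn : 1 ≤ n) (hcU : c < meanDuration n (peakTime n)) :
    IsLeast {i : ℕ | 1 ≤ i ∧ i ≤ n ∧ 0 ≤ meanDuration n i - c} (firstTime n c) :=
  ⟨Nat.sInf_mem ⟨_, peakTime_mem hn hcU⟩, fun _ hi => Nat.sInf_le hi⟩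

lemma lastTime_isGreatest (hn : 1 ≤ n) (hcU : c < meanDuration n (peakTime n)) :
    IsGreatest {i : ℕ | 1 ≤ i ∧ i ≤ n ∧ 0 ≤ meanDuration n i - c} (lastTime n c) := by
  have hb : BddAbove {i : ℕ | 1 ≤ i ∧ i ≤ n ∧ 0 ≤ meanDuration n i - c} :=
    ⟨n, fun i hi => hi.2.1⟩
  exact ⟨Nat.sSup_mem ⟨_, peakTime_mem hn hcU⟩ hb, fun i hi => le_csSup hb hi⟩

lemma nonneg_iff_mem_interval (hn : 1 ≤ n) (hcU : c < meanDuration n (peakTime n)) {i : ℕ}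
    (hi : 1 ≤ i) (hin : i ≤ n) :
    0 ≤ meanDuration n i - c ↔ firstTime n c ≤ i ∧ i ≤ lastTime n c := by
  have hf := firstTime_isLeast hn hcU
  have hl := lastTime_isGreatest hn hcU
  refine ⟨fun h => ⟨hf.2 ⟨hi, hin, h⟩, hl.2 ⟨hi, hin, h⟩⟩, fun ⟨h1, h2⟩ => ?_⟩
  obtain ⟨hf1, hf2, hf3⟩ := hf.1
  obtain ⟨hl1, hl2, hl3⟩ := hl.1
  rw [meanDuration_eq hf1 hf2] at hf3
  rw [meanDuration_eq hl1 hl2] at hl3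
  rw [meanDuration_eq hi hin]
  rcases le_total i (peakTime n) with h | h
  · linarith [meanDurationFormula_mono hn hf1 h1 h]
  · linarith [meanDurationFormula_anti hn h h2]

lemma acquisitionGain_last (hb : 1 ≤ lastTime n c) :
    acquisitionGain n c (lastTime n c)
      = (meanDurationFormula n (lastTime n c) - c) / lastTime n c := by
  rw [acquisitionGain, Finset.Icc_eq_empty (by omega), Finset.sum_empty, meanDurationFormula]
  have : (lastTime n c : ℝ) ≠ 0 := Nat.cast_ne_zero.2 (by omega)
  field_simp
  ring

lemma acquisitionGain_succ {i : ℕ} (hi : 1 ≤ i) (hib : i < lastTime n c) :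
    acquisitionGain n c (i + 1)
      = acquisitionGain n c i + ((harmonic n : ℝ) - harmonic i - 1) / i := by
  obtain ⟨i, rfl⟩ := Nat.exists_eq_add_of_le' hi
  unfold acquisitionGain
  rw [sum_Icc_eq_add_sum_Icc_succ (Nat.succ_le_of_lt hib)]
  simp only [Nat.succ_eq_add_one, Nat.add_sub_cancel, harmonic_succ_cast]
  push_cast
  have : (i : ℝ) + 1 ≠ 0 := by positivity
  have e : (i : ℝ) + 1 + 1 - 1 = i + 1 := by ring
  rw [e]
  field_simp
  ring

end Peak

/-! ### The value of the threshold strategy, and the sign of the advantage of selecting. -/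

section Value

variable {n : ℕ} {c : ℝ} {s : ℕ → ℕ}

/-- The expected net payoff from the times `i, i + 1, …, n` of the threshold strategy with `k`
choices left. -/
noncomputable def value (n : ℕ) (c : ℝ) (s : ℕ → ℕ) (k i : ℕ) : ℝ :=
  ∑ j ∈ Finset.Icc (max i (s k)) (lastTime n c), gain (lastTime n c) (acquisitionGain n c) s k j

lemma value_zero (i : ℕ) : value n c s 0 i = 0 := by simp [value, gain]

lemma value_of_lt {k i : ℕ} (hi : lastTime n c < i) : value n c s k i = 0 := by
  rw [value, Finset.Icc_eq_empty (by simp only [max_le_iff]; omega), Finset.sum_empty]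

lemma value_eq {k i : ℕ} (hi : i ≤ lastTime n c) :
    value n c s k i = (if s k ≤ i then gain (lastTime n c) (acquisitionGain n c) s k i else 0)
      + value n c s k (i + 1) :=
  sum_Icc_max hi _

/-- The difference of values isolates the term j = i + 1 of the sum, whose weight 1/(j - 1) is 1/i.
-/
lemma gain_succ {k i : ℕ} (hi : 1 ≤ i) (hib : i < lastTime n c) :
    gain (lastTime n c) (acquisitionGain n c) s (k + 1) i
      = gain (lastTime n c) (acquisitionGain n c) s (k + 1) (i + 1)
        + (value n c s k (i + 1) - value n c s k (i + 2)
          - ((harmonic n : ℝ) - harmonic i - 1)) / i := by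
  cases k with
  | zero =>
    simp only [gain, value_zero, acquisitionGain_succ hi hib]
    ring
  | succ k =>
    rw [value_eq (show i + 1 ≤ lastTime n c from hib)]
    simp only [gain]
    rw [sum_Icc_max (show i + 1 ≤ lastTime n c from hib), acquisitionGain_succ hi hib]
    push_cast
    rw [add_sub_cancel_right]
    split_ifs <;> ring

/-- The gain from choosing a candidate at time `i`, with `k + 1` choices left, instead of
passing it over. -/
noncomputable def advantage (n : ℕ) (c : ℝ) (s : ℕ → ℕ) (k i : ℕ) : ℝ :=
  meanDurationFormula n i - c + value n c s k (i + 1) - value n c s (k + 1) (i + 1)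

/-- Backward induction from b, after which all values vanish. The hypothesis reaches one time below
the critical number, because `advantage_nonpos` starts its descent there. -/
lemma advantage_eq {k i : ℕ} (hi : 1 ≤ i) (hib : i ≤ lastTime n c) (his : s (k + 1) ≤ i + 1) :
    advantage n c s k i = i * gain (lastTime n c) (acquisitionGain n c) s (k + 1) i := by
  induction hib using Nat.decreasingInduction with
  | self =>
    rw [advantage, value_of_lt (Nat.lt_succ_self _), value_of_lt (Nat.lt_succ_self _),
      gain_of_le (by omega) le_rfl, acquisitionGain_last hi]
    have : (lastTime n c : ℝ) ≠ 0 := Nat.cast_ne_zero.2 (by omega)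
    field_simp
    ring
  | of_succ i hlt ih =>
    have hlt : i < lastTime n c := hlt
    have ih := ih (by omega) (by omega)
    have h0 : (i : ℝ) ≠ 0 := Nat.cast_ne_zero.2 (by omega)
    rw [advantage, meanDurationFormula_succ_sub hi] at ih
    rw [gain_succ hi hlt, advantage, value_eq (k := k + 1) (show i + 1 ≤ lastTime n c from hlt),
      if_pos his]
    push_cast at ih
    field_simp
    linarith

variable (hn : 1 ≤ n)
  (h : ∀ k, 1 ≤ k → CriticalProperties (lastTime n c) (peakTime n) (acquisitionGain n c) s k)

include h in
lemma advantage_nonneg {k i : ℕ} (hib : i ≤ lastTime n c) (his : s (k + 1) ≤ i) :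
    0 ≤ advantage n c s k i := by
  have hk := h (k + 1) (by omega)
  rw [advantage_eq (hk.isLeast.1.1.trans his) hib (by omega)]
  exact mul_nonneg (Nat.cast_nonneg i) (hk.nonneg i his hib)

include hn h in
-- Just below the critical number the advantage is i times a negative gain. Further down both values
-- are constant, so the advantage varies as U does, and U increases below K(n).
lemma advantage_nonpos {k i : ℕ} (hi : 1 ≤ i) (his : i < s (k + 1)) :
    advantage n c s k i ≤ 0 := by
  have hk := h (k + 1) (by omega)
  have hsb := hk.isLeast.1.2.1
  have hsK := hk.le_peak
  obtain ⟨t, ht⟩ : ∃ t, s (k + 1) = t + 1 := ⟨s (k + 1) - 1, by omega⟩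
  have hit : i ≤ t := by omega
  induction hit using Nat.decreasingInduction with
  | self =>
    rw [advantage_eq hi (by omega) ht.le]
    exact mul_nonpos_of_nonneg_of_nonpos (Nat.cast_nonneg t) (hk.neg hi his).le
  | of_succ i hlt ih =>
    have hlt : i < t := hlt
    have ih := ih (by omega) (by omega)
    have hpk := one_lt_of_lt_peakTime hn hi (by omega)
    have hv : value n c s k (i + 1) = value n c s k (i + 1 + 1) := by
      cases k with
      | zero => simp only [value_zero]
      | succ k =>
        have := (h (k + 1) (by omega)).succ_le hk
        rw [value_eq (by omega), if_neg (by omega), zero_add]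
    have hv' : value n c s (k + 1) (i + 1) = value n c s (k + 1) (i + 1 + 1) := by
      rw [value_eq (by omega), if_neg (by omega), zero_add]
    rw [advantage, meanDurationFormula_succ_sub hi] at ih
    rw [advantage, hv, hv']
    linarith

lemma advantage_nonpos_of_lt (hn : 1 ≤ n) (hcU : c < meanDuration n (peakTime n)) {k i : ℕ}
    (hib : lastTime n c < i) (hin : i ≤ n) : advantage n c s k i ≤ 0 := by
  have hi : 1 ≤ i := by omega
  rw [advantage, value_of_lt (by omega), value_of_lt (by omega), ← meanDuration_eq hi hin]
  by_contra! h0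
  have := (lastTime_isGreatest hn hcU).2 ⟨hi, hin, by linarith⟩
  omega

include h in
lemma value_le_value_succ {k i : ℕ} (hk : 1 ≤ k) (hi : 1 ≤ i) :
    value n c s k i ≤ value n c s (k + 1) i := by
  have hk1 := h k hk
  have hk2 := h (k + 1) (by omega)
  unfold value
  calc _ ≤ ∑ j ∈ Finset.Icc (max i (s k)) (lastTime n c),
        gain (lastTime n c) (acquisitionGain n c) s (k + 1) j := by
        refine Finset.sum_le_sum fun j hj => ?_
        simp only [Finset.mem_Icc, max_le_iff] at hj
        exact hk1.le_next j (by omega) hj.2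
    _ ≤ _ := by
        refine Finset.sum_le_sum_of_subset_of_nonneg
          (Finset.Icc_subset_Icc_left (max_le_max le_rfl (hk1.succ_le hk2))) fun j hj _ => ?_
        simp only [Finset.mem_Icc, max_le_iff] at hj
        exact hk2.nonneg j hj.1.2 hj.2

include h in
lemma value_nonneg {k i : ℕ} (hk : 1 ≤ k) : 0 ≤ value n c s k i := by
  refine Finset.sum_nonneg fun j hj => ?_
  simp only [Finset.mem_Icc, max_le_iff] at hj
  exact (h k hk).nonneg j hj.1.2 hj.2

include h in
-- At the critical number selecting is at least as good as passing, although it leaves a choice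
-- fewer and hence no larger a continuation value; so U ≥ c there.
lemma firstTime_le_criticalNumber (hn : 1 ≤ n) (hcU : c < meanDuration n (peakTime n)) {k : ℕ}
    (hk : 1 ≤ k) : firstTime n c ≤ s k := by
  obtain ⟨k, rfl⟩ := Nat.exists_eq_add_of_le' hk
  have hmem := (h (k + 1) hk).isLeast.1
  have hbn := (lastTime_isGreatest hn hcU).1.2.1
  have hadv := advantage_nonneg h hmem.2.1 le_rfl
  have hv : value n c s k (s (k + 1) + 1) ≤ value n c s (k + 1) (s (k + 1) + 1) := by
    cases k with
    | zero => rw [value_zero]; exact value_nonneg h hk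
    | succ k => exact value_le_value_succ h (by omega) (by omega)
  refine (firstTime_isLeast hn hcU).2 ⟨hmem.1, hmem.2.1.trans hbn, ?_⟩
  rw [meanDuration_eq hmem.1 (hmem.2.1.trans hbn)]
  rw [advantage] at hadv
  linarith

lemma criticalProperties_acquisitionGain (hn : 1 ≤ n) (hcU : c < meanDuration n (peakTime n))
    (hs : ∀ k, s k = sInf {i : ℕ | 1 ≤ i ∧ i ≤ lastTime n c ∧
      0 ≤ gain (lastTime n c) (acquisitionGain n c) s k i}) {k : ℕ} (hk : 1 ≤ k) :
    CriticalProperties (lastTime n c) (peakTime n) (acquisitionGain n c) s k := by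
  have hK := (peakTime_isLeast hn).1.1
  have hg := lastTime_isGreatest hn hcU
  have hKb : peakTime n ≤ lastTime n c := hg.2 (peakTime_mem hn hcU)
  refine criticalProperties hs hK hKb (fun i hi hiK => ?_) (fun i hKi hib => ?_) hk
  · rw [acquisitionGain_succ hi (by omega), le_add_iff_nonneg_right]
    have := one_lt_of_lt_peakTime hn hi hiK
    exact div_nonneg (by linarith) (Nat.cast_nonneg i)
  · induction hib using Nat.decreasingInduction with
    | self =>
      have := hg.1.2.2
      rw [meanDuration_eq hg.1.1 hg.1.2.1] at this
      rw [acquisitionGain_last hg.1.1]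
      exact div_nonneg this (Nat.cast_nonneg _)
    | of_succ i hlt ih =>
      have ih := ih (by omega)
      rw [acquisitionGain_succ (by omega) hlt] at ih
      have h1 := le_one_of_peakTime_le hn hKi
      have : ((harmonic n : ℝ) - harmonic i - 1) / i ≤ 0 :=
        div_nonpos_of_nonpos_of_nonneg (by linarith) (Nat.cast_nonneg i)
      linarith

end Value

/-! ### The Bellman equation. -/

section StateValue

variable {n : ℕ} {c : ℝ} {s : ℕ → ℕ}

open Classical in
/-- The maximal conditional expected net payoff of `k` choices at the times `i, …, n`, given the
observations up to time `i`. -/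
noncomputable def stateValue (c : ℝ) (s : ℕ → ℕ) : ℕ → ℕ → Equiv.Perm (Fin n) → ℝ
  | 0, _, _ => 0
  | k + 1, i, σ =>
    value n c s (k + 1) (i + 1) + if IsCandidate σ i then max 0 (advantage n c s k i) else 0

lemma stateValue_congr {k i : ℕ} {σ σ' : Equiv.Perm (Fin n)} (h : history i σ = history i σ') :
    stateValue c s k i σ = stateValue c s k i σ' := by
  cases k with
  | zero => rfl
  | succ k =>
    classical
    rw [stateValue, stateValue, if_congr (isCandidate_congr le_rfl h) rfl rfl]

lemma value_le_stateValue (k i : ℕ) (σ : Equiv.Perm (Fin n)) :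
    value n c s k (i + 1) ≤ stateValue c s k i σ := by
  cases k with
  | zero => simp [value_zero, stateValue]
  | succ k =>
    rw [stateValue, le_add_iff_nonneg_right]
    split_ifs
    exacts [le_max_left _ _, le_rfl]

lemma select_le_stateValue {k i : ℕ} {σ : Equiv.Perm (Fin n)} (h : IsCandidate σ i) :
    meanDurationFormula n i - c + value n c s k (i + 1) ≤ stateValue c s (k + 1) i σ := by
  rw [stateValue, if_pos h]
  have := le_max_right 0 (advantage n c s k i)
  rw [advantage] at this ⊢
  linarith

lemma stateValue_end (hb : lastTime n c ≤ n) (k : ℕ) (σ : Equiv.Perm (Fin n)) :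
    stateValue c s k (n + 1) σ = 0 := by
  cases k with
  | zero => rfl
  | succ k =>
    rw [stateValue, if_neg fun hc => by have := hc.bounds; omega, value_of_lt (by omega), add_zero]

variable (hn : 1 ≤ n) (hcU : c < meanDuration n (peakTime n))
  (h : ∀ k, 1 ≤ k → CriticalProperties (lastTime n c) (peakTime n) (acquisitionGain n c) s k)

include h in
lemma stateValue_of_select {k i : ℕ} {σ : Equiv.Perm (Fin n)} (hσ : IsCandidate σ i)
    (his : s (k + 1) ≤ i) (hib : i ≤ lastTime n c) :
    stateValue c s (k + 1) i σ = meanDurationFormula n i - c + value n c s k (i + 1) := by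
  rw [stateValue, if_pos hσ, max_eq_right (advantage_nonneg h hib his), advantage]
  ring

include hn hcU h in
lemma stateValue_of_pass {k i : ℕ} {σ : Equiv.Perm (Fin n)} (hi : 1 ≤ i) (hin : i ≤ n)
    (hσ : ¬ (IsCandidate σ i ∧ s (k + 1) ≤ i ∧ i ≤ lastTime n c)) :
    stateValue c s (k + 1) i σ = value n c s (k + 1) (i + 1) := by
  rw [stateValue, add_eq_left]
  split_ifs with hc
  · refine max_eq_left ?_
    by_cases his : s (k + 1) ≤ i
    · exact advantage_nonpos_of_lt hn hcU (not_le.1 fun hib => hσ ⟨hc, his, hib⟩) hin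
    · exact advantage_nonpos hn h hi (not_le.1 his)
  · rfl

include hn hcU h in
-- The signs of the advantage identify its positive part with (i + 1) times the gain on the
-- selection interval and with 0 elsewhere.
lemma value_succ_eq {k i : ℕ} (hi : i < n) :
    value n c s (k + 1) (i + 1) = value n c s (k + 1) (i + 1 + 1)
      + 1 / ((i : ℝ) + 1) * max 0 (advantage n c s k (i + 1)) := by
  have h0 : (i : ℝ) + 1 ≠ 0 := by positivity
  by_cases hib : i + 1 ≤ lastTime n c
  · rw [value_eq hib]
    split_ifs with his
    · rw [max_eq_right (advantage_nonneg h hib his), advantage_eq (by omega) hib (by omega)]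
      push_cast
      field_simp
      ring
    · rw [max_eq_left (advantage_nonpos hn h (by omega) (not_le.1 his))]
      ring
  · rw [value_of_lt (not_le.1 hib), value_of_lt (by omega),
      max_eq_left (advantage_nonpos_of_lt hn hcU (not_le.1 hib) hi)]
    ring

include hn hcU h in
lemma sum_stateValue {k i : ℕ} (hi : i ≤ n) (σ₀ : Equiv.Perm (Fin n)) :
    ∑ σ ∈ sameHistory i σ₀, stateValue c s k (i + 1) σ
      = (sameHistory i σ₀).card * value n c s k (i + 1) := by
  classical
  have hb := (lastTime_isGreatest hn hcU).1.2.1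
  cases k with
  | zero => simp [stateValue, value_zero]
  | succ k =>
    rcases hi.lt_or_eq with hi | rfl
    · simp only [stateValue]
      rw [Finset.sum_add_distrib, sum_ite_candidate hi, value_succ_eq hn hcU h hi]
      simp only [Finset.sum_const, nsmul_eq_mul]
      ring
    · rw [value_of_lt (by omega), Finset.sum_eq_zero fun σ _ => stateValue_end hb _ σ, mul_zero]

end StateValue

/-! ### No strategy exceeds the value. -/

section UpperBound

variable {n : ℕ}

/-- Admissibility of a strategy on a set of rankings. -/
structure IsAdmissibleOn (S : Finset (Equiv.Perm (Fin n))) (k i : ℕ)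
    (τ : Fin k → Equiv.Perm (Fin n) → WithTop ℕ) : Prop where
  adapted : ∀ l, ∀ σ ∈ S, ∀ σ' ∈ S, ∀ j : ℕ, history j σ = history j σ' →
    τ l σ = (j : WithTop ℕ) → τ l σ' = (j : WithTop ℕ)
  candidate : ∀ l, ∀ σ ∈ S, ∀ j : ℕ, τ l σ = (j : WithTop ℕ) → IsCandidate σ j
  start : ∀ l, ∀ σ ∈ S, (i : WithTop ℕ) ≤ τ l σ
  increasing : ∀ l l', ∀ σ ∈ S, l < l' → τ l σ < τ l' σ ∨ (τ l σ = ⊤ ∧ τ l' σ = ⊤)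

lemma IsAdmissibleOn.mono {S S' : Finset (Equiv.Perm (Fin n))} {k i : ℕ}
    {τ : Fin k → Equiv.Perm (Fin n) → WithTop ℕ} (h : IsAdmissibleOn S k i τ) (hS : S' ⊆ S) :
    IsAdmissibleOn S' k i τ where
  adapted l σ hσ σ' hσ' := h.adapted l σ (hS hσ) σ' (hS hσ')
  candidate l σ hσ := h.candidate l σ (hS hσ)
  start l σ hσ := h.start l σ (hS hσ)
  increasing l l' σ hσ := h.increasing l l' σ (hS hσ)

lemma measurableSet_rankFiltration_iff {j : ℕ} {A : Set (Equiv.Perm (Fin n))} :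
    @MeasurableSet _ (rankFiltration n j) A
      ↔ ∀ σ σ', history j σ = history j σ' → σ ∈ A → σ' ∈ A := by
  constructor
  · rintro ⟨B, -, rfl⟩ σ σ' h hσ
    rw [Set.mem_preimage] at hσ ⊢
    rwa [← h]
  · intro h
    refine ⟨history j '' A, trivial, ?_⟩
    ext σ
    constructor
    · rintro ⟨ρ, hρ, he⟩
      exact h ρ σ he hρ
    · exact fun hσ => ⟨σ, hσ, rfl⟩

/-- Backward induction works inside one class of observations, so admissibility is needed only
there; stopping times become functions whose event {τ = j} depends only on the history up to j. -/
lemma IsAdmissible.isAdmissibleOn {k i : ℕ} {τ : Fin k → Equiv.Perm (Fin n) → WithTop ℕ}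
    (h : IsAdmissible k i τ) (S : Finset (Equiv.Perm (Fin n))) : IsAdmissibleOn S k i τ where
  adapted l σ _ σ' _ j hh hj := by
    have hle : ∀ t : ℕ, ∀ ρ ρ', history t ρ = history t ρ' → τ l ρ ≤ t → τ l ρ' ≤ t :=
      fun t => measurableSet_rankFiltration_iff.1 (h.stopping l t)
    have h1 := hle j σ σ' hh hj.le
    obtain ⟨t, ht⟩ := WithTop.ne_top_iff_exists.1 (h1.trans_lt (WithTop.coe_lt_top j)).ne
    rw [← ht] at h1 ⊢
    have htj : t ≤ j := WithTop.coe_le_coe.1 h1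
    have h2 := hle t σ' σ (history_eq_mono htj hh.symm) ht.ge
    rw [hj] at h2
    exact congrArg _ (le_antisymm htj (WithTop.coe_le_coe.1 h2))
  candidate l σ _ := h.candidate l σ
  start l σ _ := h.start l σ
  increasing l l' σ _ := h.increasing l l' σ

lemma netPayoff_top (c : ℝ) (σ : Equiv.Perm (Fin n)) : netPayoff c σ ⊤ = 0 := rfl

lemma totalPayoff_succ {k : ℕ} (c : ℝ) (τ : Fin (k + 1) → Equiv.Perm (Fin n) → WithTop ℕ)
    (σ : Equiv.Perm (Fin n)) :
    totalPayoff c τ σ = netPayoff c σ (τ 0 σ) + totalPayoff c (fun l => τ l.succ) σ := by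
  rw [totalPayoff, Fin.sum_univ_succ, totalPayoff]

lemma totalPayoff_end {k : ℕ} {c : ℝ} {τ : Fin k → Equiv.Perm (Fin n) → WithTop ℕ}
    {σ : Equiv.Perm (Fin n)} (hc : ∀ l, ∀ j : ℕ, τ l σ = (j : WithTop ℕ) → IsCandidate σ j)
    (hs : ∀ l, ((n + 1 : ℕ) : WithTop ℕ) ≤ τ l σ) : totalPayoff c τ σ = 0 := by
  refine Finset.sum_eq_zero fun l _ => ?_
  cases hτ : τ l σ with
  | top => exact netPayoff_top c σ
  | coe j =>
    have h1 := (hc l j hτ).bounds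
    have h2 := hs l
    rw [hτ] at h2
    have := WithTop.coe_le_coe.1 h2
    simp only [Nat.cast_id] at this
    omega

lemma succ_le_of_lt_withTop {i : ℕ} {x : WithTop ℕ} (h : (i : WithTop ℕ) < x) :
    ((i + 1 : ℕ) : WithTop ℕ) ≤ x := by
  cases x with
  | top => exact le_top
  | coe j => exact WithTop.coe_le_coe.2 (WithTop.coe_lt_coe.1 h)

variable {c : ℝ} {s : ℕ → ℕ} (hn : 1 ≤ n) (hcU : c < meanDuration n (peakTime n))
  (h : ∀ k, 1 ≤ k → CriticalProperties (lastTime n c) (peakTime n) (acquisitionGain n c) s k)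

lemma sum_stateValue_sameHistory (k i : ℕ) (σ₀ : Equiv.Perm (Fin n)) :
    ∑ σ ∈ sameHistory i σ₀, stateValue c s k i σ
      = (sameHistory i σ₀).card * stateValue c s k i σ₀ := by
  rw [Finset.sum_congr rfl fun σ hσ => stateValue_congr (mem_sameHistory.1 hσ),
    Finset.sum_const, nsmul_eq_mul]

lemma sum_select {k i : ℕ} {τ : Fin (k + 1) → Equiv.Perm (Fin n) → WithTop ℕ}
    {σ₀ : Equiv.Perm (Fin n)} (hi : 1 ≤ i) (hin : i ≤ n)
    (hτ : ∀ σ ∈ sameHistory i σ₀, τ 0 σ = (i : WithTop ℕ)) :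
    ∑ σ ∈ sameHistory i σ₀, totalPayoff c τ σ
      = (sameHistory i σ₀).card * (meanDurationFormula n i - c)
        + ∑ σ ∈ sameHistory i σ₀, totalPayoff c (fun l => τ l.succ) σ := by
  have e : ∀ σ ∈ sameHistory i σ₀, totalPayoff c τ σ
      = duration σ i - c + totalPayoff c (fun l => τ l.succ) σ := by
    intro σ hσ
    rw [totalPayoff_succ, hτ σ hσ]
    rfl
  rw [Finset.sum_congr rfl e, Finset.sum_add_distrib, Finset.sum_sub_distrib,
    sum_duration hi hin, Finset.sum_const, nsmul_eq_mul]
  ring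

include hn hcU h in
/-- No strategy does better than the value. -/
theorem sum_totalPayoff_le {i : ℕ} (hi : 1 ≤ i) (hin : i ≤ n + 1) {k : ℕ}
    {τ : Fin k → Equiv.Perm (Fin n) → WithTop ℕ} (σ₀ : Equiv.Perm (Fin n))
    (hτ : IsAdmissibleOn (sameHistory i σ₀) k i τ) :
    ∑ σ ∈ sameHistory i σ₀, totalPayoff c τ σ
      ≤ (sameHistory i σ₀).card * stateValue c s k i σ₀ := by
  have hb := (lastTime_isGreatest hn hcU).1.2.1
  induction hin using Nat.decreasingInduction generalizing k σ₀ with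
  | self =>
    rw [stateValue_end hb, mul_zero]
    exact (Finset.sum_eq_zero fun σ hσ => totalPayoff_end (fun l => hτ.candidate l σ hσ)
      fun l => hτ.start l σ hσ).le
  | of_succ i hlt ih =>
    have hin : i ≤ n := Nat.lt_succ_iff.1 hlt
    -- If nothing further is chosen at i, split the class by the observation at i + 1 and average
    -- the bounds from the induction hypothesis.
    have hwait : ∀ (k : ℕ) (τ : Fin k → Equiv.Perm (Fin n) → WithTop ℕ),
        IsAdmissibleOn (sameHistory i σ₀) k (i + 1) τ →
        ∑ σ ∈ sameHistory i σ₀, totalPayoff c τ σ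
          ≤ (sameHistory i σ₀).card * value n c s k (i + 1) := by
      intro k τ hτ
      rw [← sum_stateValue hn hcU h hin]
      refine sum_le_sum_of_sameHistory (j := i + 1)
        (fun σ hσ => sameHistory_subset (Nat.le_succ i) hσ) fun σ hσ => ?_
      rw [sum_stateValue_sameHistory]
      exact ih (by omega) σ (hτ.mono (sameHistory_subset (Nat.le_succ i) hσ))
    cases k with
    | zero => simp [totalPayoff, stateValue]
    | succ k =>
      have hself := self_mem_sameHistory i σ₀
      -- By adaptedness the first choice is made at i on the whole class or nowhere in it.
      by_cases h0 : τ 0 σ₀ = (i : WithTop ℕ)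
      · have hall : ∀ σ ∈ sameHistory i σ₀, τ 0 σ = (i : WithTop ℕ) := fun σ hσ =>
          hτ.adapted 0 σ₀ hself σ hσ i (mem_sameHistory.1 hσ).symm h0
        -- The remaining choices are known to start at i + 1 only on this class, hence the localized
        -- notion.
        have htail : IsAdmissibleOn (sameHistory i σ₀) k (i + 1) fun l => τ l.succ :=
          { adapted := fun l => hτ.adapted l.succ
            candidate := fun l => hτ.candidate l.succ
            start := fun l σ hσ => by
              rcases hτ.increasing 0 l.succ σ hσ l.succ_pos with hlt | ⟨-, htop⟩
              · rw [hall σ hσ] at hlt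
                exact succ_le_of_lt_withTop hlt
              · simp only [htop]
                exact le_top
            increasing := fun l l' σ hσ hl =>
              hτ.increasing l.succ l'.succ σ hσ (Fin.succ_lt_succ_iff.2 hl) }
        rw [sum_select hi hin hall]
        calc _ ≤ ((sameHistory i σ₀).card : ℝ) * (meanDurationFormula n i - c)
              + (sameHistory i σ₀).card * value n c s k (i + 1) :=
              add_le_add_right (hwait k _ htail) _
          _ = (sameHistory i σ₀).card
              * (meanDurationFormula n i - c + value n c s k (i + 1)) := by ring
          _ ≤ _ := mul_le_mul_of_nonneg_left
              (select_le_stateValue (hτ.candidate 0 σ₀ hself i h0)) (Nat.cast_nonneg _)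
      · have hlt : ∀ σ ∈ sameHistory i σ₀, (i : WithTop ℕ) < τ 0 σ := fun σ hσ =>
          lt_of_le_of_ne (hτ.start 0 σ hσ) fun he =>
            h0 (hτ.adapted 0 σ hσ σ₀ hself i (mem_sameHistory.1 hσ) he.symm)
        refine (hwait (k + 1) τ ⟨hτ.adapted, hτ.candidate, fun l σ hσ => ?_,
          hτ.increasing⟩).trans
          (mul_le_mul_of_nonneg_left (value_le_stateValue _ _ _) (Nat.cast_nonneg _))
        cases l using Fin.cases with
        | zero => exact succ_le_of_lt_withTop (hlt σ hσ)
        | succ l =>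
          rcases hτ.increasing 0 l.succ σ hσ l.succ_pos with hl | ⟨-, htop⟩
          · exact succ_le_of_lt_withTop ((hlt σ hσ).trans hl)
          · rw [htop]
            exact le_top

end UpperBound

/-! ### The threshold strategy is admissible and attains the value. -/

section Threshold

variable {n : ℕ} {s : ℕ → ℕ} {b : ℕ}

lemma firstCandidate_eq_coe {σ : Equiv.Perm (Fin n)} {lo hi j : ℕ} (h1 : lo ≤ j) (h2 : j ≤ hi)
    (h3 : IsCandidate σ j) (h4 : ∀ t, lo ≤ t → t < j → ¬ IsCandidate σ t) :
    firstCandidate σ lo hi = (j : WithTop ℕ) := by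
  refine IsLeast.csInf_eq ⟨⟨j, rfl, h1, h2, h3⟩, ?_⟩
  rintro _ ⟨t, rfl, ht1, -, ht3⟩
  exact WithTop.coe_le_coe.2 (not_lt.1 fun hlt => h4 t ht1 hlt ht3)

lemma firstCandidate_spec (σ : Equiv.Perm (Fin n)) (lo hi : ℕ) :
    firstCandidate σ lo hi = ⊤ ∨ ∃ j : ℕ, firstCandidate σ lo hi = (j : WithTop ℕ) ∧ lo ≤ j ∧
      j ≤ hi ∧ IsCandidate σ j ∧ ∀ t, lo ≤ t → t < j → ¬ IsCandidate σ t := by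
  classical
  by_cases h : ∃ j, lo ≤ j ∧ j ≤ hi ∧ IsCandidate σ j
  · obtain ⟨h1, h2, h3⟩ := Nat.find_spec h
    have h4 : ∀ t, lo ≤ t → t < Nat.find h → ¬ IsCandidate σ t := fun t ht hlt hc =>
      Nat.find_min h hlt ⟨ht, hlt.le.trans h2, hc⟩
    exact Or.inr ⟨_, firstCandidate_eq_coe h1 h2 h3 h4, h1, h2, h3, h4⟩
  · left
    have : {x : WithTop ℕ | ∃ j : ℕ, x = (j : WithTop ℕ) ∧ lo ≤ j ∧ j ≤ hi ∧ IsCandidate σ j}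
        = ∅ := by
      ext x
      simp only [Set.mem_ofPred_eq, Set.mem_empty_iff_false, iff_false]
      rintro ⟨j, -, hj⟩
      exact h ⟨j, hj⟩
    rw [firstCandidate, this]
    exact WithTop.sInf_empty

lemma thresholdTimes_of_top {σ : Equiv.Perm (Fin n)} {k i : ℕ}
    (h : firstCandidate σ (max i (s (k + 1))) b = ⊤) (l : Fin (k + 1)) :
    thresholdTimes s b σ (k + 1) i l = ⊤ := by
  rw [thresholdTimes, h]
  cases l using Fin.cases <;> rfl

lemma thresholdTimes_of_coe {σ : Equiv.Perm (Fin n)} {k i j : ℕ}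
    (h : firstCandidate σ (max i (s (k + 1))) b = (j : WithTop ℕ)) :
    thresholdTimes s b σ (k + 1) i
      = Fin.cons (j : WithTop ℕ) (thresholdTimes s b σ k (j + 1)) := by
  rw [thresholdTimes, h]
  rfl

lemma thresholdTimes_start (σ : Equiv.Perm (Fin n)) (k i : ℕ) (l : Fin k) :
    (i : WithTop ℕ) ≤ thresholdTimes s b σ k i l := by
  induction k generalizing i with
  | zero => exact l.elim0
  | succ k ih =>
    rcases firstCandidate_spec σ (max i (s (k + 1))) b with h | ⟨j, h, hj, -⟩
    · rw [thresholdTimes_of_top h]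
      exact le_top
    · rw [thresholdTimes_of_coe h]
      have hij : i ≤ j := (le_max_left _ _).trans hj
      cases l using Fin.cases with
      | zero => exact WithTop.coe_le_coe.2 hij
      | succ l =>
        rw [Fin.cons_succ]
        exact (WithTop.coe_le_coe.2 (hij.trans (Nat.le_succ j))).trans (ih (j + 1) l)

lemma thresholdTimes_candidate (σ : Equiv.Perm (Fin n)) (k i : ℕ) (l : Fin k) {t : ℕ}
    (ht : thresholdTimes s b σ k i l = (t : WithTop ℕ)) : IsCandidate σ t := by
  induction k generalizing i with
  | zero => exact l.elim0
  | succ k ih =>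
    rcases firstCandidate_spec σ (max i (s (k + 1))) b with h | ⟨j, h, -, -, hc, -⟩
    · rw [thresholdTimes_of_top h] at ht
      exact absurd ht.symm (WithTop.coe_ne_top)
    · rw [thresholdTimes_of_coe h] at ht
      cases l using Fin.cases with
      | zero =>
        obtain rfl : j = t := WithTop.coe_injective ht
        exact hc
      | succ l => exact ih (j + 1) l (by simpa using ht)

lemma thresholdTimes_increasing (σ : Equiv.Perm (Fin n)) (k i : ℕ) (l l' : Fin k) (hl : l < l') :
    thresholdTimes s b σ k i l < thresholdTimes s b σ k i l' ∨
      (thresholdTimes s b σ k i l = ⊤ ∧ thresholdTimes s b σ k i l' = ⊤) := by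
  induction k generalizing i with
  | zero => exact l.elim0
  | succ k ih =>
    rcases firstCandidate_spec σ (max i (s (k + 1))) b with h | ⟨j, h, -⟩
    · exact Or.inr ⟨thresholdTimes_of_top h l, thresholdTimes_of_top h l'⟩
    · rw [thresholdTimes_of_coe h]
      cases l' using Fin.cases with
      | zero => exact absurd hl (Fin.not_lt_zero l)
      | succ l' =>
        cases l using Fin.cases with
        | zero =>
          left
          rw [Fin.cons_zero, Fin.cons_succ]
          exact (WithTop.coe_lt_coe.2 (Nat.lt_succ_self j)).trans_le
            (thresholdTimes_start σ k (j + 1) l')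
        | succ l =>
          rw [Fin.cons_succ, Fin.cons_succ]
          exact ih (j + 1) l l' (Fin.succ_lt_succ_iff.1 hl)

/-- Adaptedness: a choice made by time t, and all choices before it, depend only on which times up
to t carry candidates. -/
lemma thresholdTimes_congr {σ σ' : Equiv.Perm (Fin n)} {t : ℕ} (hh : history t σ = history t σ')
    (k i : ℕ) (l : Fin k) {u : ℕ} (hu : u ≤ t)
    (ht : thresholdTimes s b σ k i l = (u : WithTop ℕ)) :
    thresholdTimes s b σ' k i l = (u : WithTop ℕ) := by
  induction k generalizing i with
  | zero => exact l.elim0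
  | succ k ih =>
    rcases firstCandidate_spec σ (max i (s (k + 1))) b with h | ⟨j, h, h1, h2, h3, h4⟩
    · rw [thresholdTimes_of_top h] at ht
      exact absurd ht.symm (WithTop.coe_ne_top)
    · rw [thresholdTimes_of_coe h] at ht
      have hj : j ≤ t := by
        cases l using Fin.cases with
        | zero => exact (WithTop.coe_injective ht).trans_le hu
        | succ l =>
          rw [Fin.cons_succ] at ht
          have := thresholdTimes_start (s := s) (b := b) σ k (j + 1) l
          rw [ht] at this
          have : j + 1 ≤ u := WithTop.coe_le_coe.1 this
          omega
      have h' : firstCandidate σ' (max i (s (k + 1))) b = (j : WithTop ℕ) :=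
        firstCandidate_eq_coe h1 h2 ((isCandidate_congr hj hh).1 h3) fun v hv hvj hc =>
          h4 v hv hvj ((isCandidate_congr (hvj.le.trans hj) hh).2 hc)
      rw [thresholdTimes_of_coe h']
      cases l using Fin.cases with
      | zero => exact ht
      | succ l =>
        rw [Fin.cons_succ] at ht ⊢
        exact ih (j + 1) l ht

lemma isAdmissible_thresholdStrategy (s : ℕ → ℕ) (b k i : ℕ) :
    IsAdmissible k i (thresholdStrategy (n := n) s b k i) where
  stopping l t := by
    refine measurableSet_rankFiltration_iff.2 fun σ σ' hh hσ => ?_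
    have hσ : thresholdTimes s b σ k i l ≤ (t : WithTop ℕ) := hσ
    obtain ⟨u, hu⟩ := WithTop.ne_top_iff_exists.1 (hσ.trans_lt (WithTop.coe_lt_top t)).ne
    rw [← hu] at hσ
    have := thresholdTimes_congr hh k i l (WithTop.coe_le_coe.1 hσ) hu.symm
    change thresholdTimes s b σ' k i l ≤ (t : WithTop ℕ)
    rw [this]
    exact hσ
  candidate l σ _ ht := thresholdTimes_candidate σ k i l ht
  start l σ := thresholdTimes_start σ k i l
  increasing l l' σ hl := thresholdTimes_increasing σ k i l l' hl

lemma thresholdTimes_pass {σ : Equiv.Perm (Fin n)} {k i : ℕ}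
    (h : ¬ (IsCandidate σ i ∧ s (k + 1) ≤ i ∧ i ≤ b)) :
    thresholdTimes s b σ (k + 1) i = thresholdTimes s b σ (k + 1) (i + 1) := by
  have he : firstCandidate σ (max i (s (k + 1))) b
      = firstCandidate σ (max (i + 1) (s (k + 1))) b := by
    unfold firstCandidate
    congr 1
    ext x
    refine exists_congr fun j => and_congr_right fun _ => ?_
    simp only [max_le_iff]
    constructor
    · rintro ⟨⟨h1, h2⟩, h3, h4⟩
      refine ⟨⟨lt_of_le_of_ne h1 ?_, h2⟩, h3, h4⟩
      rintro rfl
      exact h ⟨h4, h2, h3⟩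
    · rintro ⟨⟨h1, h2⟩, h3⟩
      exact ⟨⟨by omega, h2⟩, h3⟩
  rw [thresholdTimes, thresholdTimes, he]

lemma thresholdTimes_select {σ : Equiv.Perm (Fin n)} {k i : ℕ}
    (hc : IsCandidate σ i) (his : s (k + 1) ≤ i) (hib : i ≤ b) :
    thresholdTimes s b σ (k + 1) i
      = Fin.cons (i : WithTop ℕ) (thresholdTimes s b σ k (i + 1)) := by
  refine thresholdTimes_of_coe (firstCandidate_eq_coe (by simp [his]) hib hc fun t ht hlt => ?_)
  simp only [max_le_iff] at ht
  omega

variable {c : ℝ} (hn : 1 ≤ n) (hcU : c < meanDuration n (peakTime n))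
  (h : ∀ k, 1 ≤ k → CriticalProperties (lastTime n c) (peakTime n) (acquisitionGain n c) s k)

include hn hcU h in
/-- The threshold strategy attains the value. -/
theorem sum_totalPayoff_thresholdStrategy {i : ℕ} (hi : 1 ≤ i) (hin : i ≤ n + 1) (k : ℕ)
    (σ₀ : Equiv.Perm (Fin n)) :
    ∑ σ ∈ sameHistory i σ₀, totalPayoff c (thresholdStrategy s (lastTime n c) k i) σ
      = (sameHistory i σ₀).card * stateValue c s k i σ₀ := by
  have hb := (lastTime_isGreatest hn hcU).1.2.1
  induction hin using Nat.decreasingInduction generalizing k σ₀ with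
  | self =>
    rw [stateValue_end hb, mul_zero]
    exact Finset.sum_eq_zero fun σ hσ => totalPayoff_end
      (fun l _ hj => thresholdTimes_candidate σ k _ l hj) fun l => thresholdTimes_start σ k _ l
  | of_succ i hlt ih =>
    have hin : i ≤ n := Nat.lt_succ_iff.1 hlt
    -- Needed for every number of choices: selecting at i continues with one fewer, passing with the
    -- same number.
    have hwait : ∀ k : ℕ,
        ∑ σ ∈ sameHistory i σ₀, totalPayoff c (thresholdStrategy s (lastTime n c) k (i + 1)) σ
          = (sameHistory i σ₀).card * value n c s k (i + 1) := by
      intro k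
      rw [← sum_stateValue hn hcU h hin]
      refine sum_eq_sum_of_sameHistory (j := i + 1)
        (fun σ hσ => sameHistory_subset (Nat.le_succ i) hσ) fun σ hσ => ?_
      rw [sum_stateValue_sameHistory]
      exact ih (by omega) k σ
    cases k with
    | zero => simp [totalPayoff, stateValue]
    | succ k =>
      have hc : ∀ σ ∈ sameHistory i σ₀, (IsCandidate σ i ↔ IsCandidate σ₀ i) :=
        fun σ hσ => isCandidate_congr le_rfl (mem_sameHistory.1 hσ)
      by_cases hsel : IsCandidate σ₀ i ∧ s (k + 1) ≤ i ∧ i ≤ lastTime n c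
      · obtain ⟨h1, h2, h3⟩ := hsel
        have ht : ∀ σ ∈ sameHistory i σ₀, thresholdTimes s (lastTime n c) σ (k + 1) i
            = Fin.cons (i : WithTop ℕ) (thresholdTimes s (lastTime n c) σ k (i + 1)) :=
          fun σ hσ => thresholdTimes_select ((hc σ hσ).2 h1) h2 h3
        have htail : ∀ σ ∈ sameHistory i σ₀,
            totalPayoff c (fun l => thresholdStrategy s (lastTime n c) (k + 1) i l.succ) σ
              = totalPayoff c (thresholdStrategy s (lastTime n c) k (i + 1)) σ := by
          intro σ hσ
          simp only [totalPayoff, thresholdStrategy, ht σ hσ, Fin.cons_succ]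
        rw [sum_select hi hin fun σ hσ => by rw [thresholdStrategy, ht σ hσ, Fin.cons_zero],
          Finset.sum_congr rfl htail, hwait, stateValue_of_select h h1 h2 h3]
        ring
      · have ht : ∀ σ ∈ sameHistory i σ₀,
            totalPayoff c (thresholdStrategy s (lastTime n c) (k + 1) i) σ
              = totalPayoff c (thresholdStrategy s (lastTime n c) (k + 1) (i + 1)) σ := by
          intro σ hσ
          have : thresholdTimes s (lastTime n c) σ (k + 1) i
              = thresholdTimes s (lastTime n c) σ (k + 1) (i + 1) :=
            thresholdTimes_pass fun hh => hsel ⟨(hc σ hσ).1 hh.1, hh.2⟩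
          simp only [totalPayoff, thresholdStrategy, this]
        rw [Finset.sum_congr rfl ht, hwait, stateValue_of_pass hn hcU h hi hin hsel]

include hn hcU h in
theorem isGreatest_mean_thresholdStrategy {k i : ℕ} (hi : 1 ≤ i) (hin : i ≤ n)
    (σ₀ : Equiv.Perm (Fin n)) :
    IsGreatest
      {v : ℝ | ∃ τ : Fin k → Equiv.Perm (Fin n) → WithTop ℕ,
        IsAdmissible k i τ ∧ v = mean (sameHistory i σ₀) (totalPayoff c τ)}
      (mean (sameHistory i σ₀)
        (totalPayoff c (thresholdStrategy (n := n) s (lastTime n c) k i))) := by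
  refine ⟨⟨_, isAdmissible_thresholdStrategy s (lastTime n c) k i, rfl⟩, ?_⟩
  rintro _ ⟨τ, hτ, rfl⟩
  unfold mean
  rw [sum_totalPayoff_thresholdStrategy hn hcU h hi (by omega)]
  exact div_le_div_of_nonneg_right
    (sum_totalPayoff_le hn hcU h hi (by omega) σ₀ (hτ.isAdmissibleOn _)) (Nat.cast_nonneg _)

end Threshold

end DurationProblem

theorem theorem4 (n m : ℕ) (hn : 1 < n) (hm : 1 ≤ m) (c : ℝ) (hc : 0 < c)
    (hcU : c < meanDuration n (peakTime n)) :
    -- the interval on which choosing a candidate has nonnegative mean net payoff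
    (1 ≤ firstTime n c ∧ firstTime n c ≤ peakTime n ∧ peakTime n ≤ lastTime n c ∧
      lastTime n c ≤ n ∧
      ∀ i : ℕ, 1 ≤ i → i ≤ n →
        (0 ≤ meanDuration n i - c ↔ firstTime n c ≤ i ∧ i ≤ lastTime n c)) ∧
    ∃ s : ℕ → ℕ,
      IsCriticalSequence (lastTime n c) m (acquisitionGain n c) s ∧
      AntitoneOn s (Set.Icc 1 m) ∧
      firstTime n c ≤ s m ∧
      -- the threshold strategy maximizes the expected net payoff
      IsGreatest
        {v : ℝ | ∃ τ : Fin m → Equiv.Perm (Fin n) → WithTop ℕ,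
          IsAdmissible m 1 τ ∧ v = mean Finset.univ (totalPayoff c τ)}
        (mean Finset.univ
          (totalPayoff c (thresholdStrategy (n := n) s (lastTime n c) m 1))) ∧
      -- it does so at any time `i`, with any number `k` of choices left, after any observations
      ∀ k : ℕ, 1 ≤ k → k ≤ m → ∀ i : ℕ, 1 ≤ i → i ≤ n → ∀ σ₀ : Equiv.Perm (Fin n),
        IsGreatest
          {v : ℝ | ∃ τ : Fin k → Equiv.Perm (Fin n) → WithTop ℕ,
            IsAdmissible k i τ ∧ v = mean (sameHistory i σ₀) (totalPayoff c τ)}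
          (mean (sameHistory i σ₀)
            (totalPayoff c (thresholdStrategy (n := n) s (lastTime n c) k i))) := by
  have hn1 : 1 ≤ n := hn.le
  have hf := firstTime_isLeast hn1 hcU
  have hl := lastTime_isGreatest hn1 hcU
  have hK := peakTime_mem hn1 hcU
  have h : ∀ k, 1 ≤ k → CriticalProperties (lastTime n c) (peakTime n) (acquisitionGain n c)
      (criticalNumber (lastTime n c) (acquisitionGain n c)) k := fun k hk =>
    criticalProperties_acquisitionGain hn1 hcU (criticalNumber_eq _ _) hk
  refine ⟨⟨hf.1.1, hf.2 hK, hl.2 hK, hl.1.2.1, fun i hi hin =>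
    nonneg_iff_mem_interval hn1 hcU hi hin⟩, criticalNumber _ _,
    isCriticalSequence_of_criticalProperties h m, antitoneOn_of_criticalProperties h m,
    firstTime_le_criticalNumber h hn1 hcU hm, ?_,
    fun k _ _ i hi hin σ₀ => isGreatest_mean_thresholdStrategy hn1 hcU h hi hin σ₀⟩
  -- The unconditional claim is the conditional one at time 1; the last argument is the identity
  -- ranking, an arbitrary representative of the only class.
  have := isGreatest_mean_thresholdStrategy hn1 hcU h (k := m) le_rfl hn1 1
  rwa [sameHistory_one] at this
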